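/- Let $X$ be a complex abelian surface of Picard number $2$. Equip $H^2(X,\mathbb Z)$ with the intersection (cup product) form. Let $\mathrm{NS}(X)\subseteq H^2(X,\mathbb Z)$ be the Néron–Severi lattice and $T(X)=\mathrm{NS}(X)^\perp\subseteq H^2(X,\mathbb Z)$ the transcendental lattice, and let $N(X)=H^0(X,\mathbb Z)\oplus \mathrm{NS}(X)\oplus H^4(X,\mathbb Z)$ with the Mukai pairing $(r,D,s)\cdot(r',D',s')=D\cdot D'-rs'-sr'$. We say that $X$ is self-mirror if there is an isometry of lattices $T(X)\cong N(X)$. Let $(A,q)$ be the discriminant form of the even lattice $\mathrm{NS}(X)$: $A=\mathrm{NS}(X)^\vee/\mathrm{NS}(X)$, where $\mathrm{NS}(X)^\vee=\{x\in \mathrm{NS}(X)\otimes\mathbb Q : x\cdot m\in\mathbb Z\text{ for all }m\in\mathrm{NS}(X)\}$, and $q\colon A\to\mathbb Q/2\mathbb Z$, $q(x+\mathrm{NS}(X))=x\cdot x \bmod 2\mathbb Z$. For a prime $p$ let $A_p\subseteq A$ be the $p$-Sylow subgroup, and let $q_2=q|_{A_2}$. Then $X$ is self-mirror if and only if both of the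 following conditions hold. (a) For every prime $p\equiv 3\pmod 4$ there is an integer $k\ge 0$ with $A_p\cong(\mathbb Z/p^k\mathbb Z)\oplus(\mathbb Z/p^k\mathbb Z)$. (b) At least one of the following holds, where $a_1,a_2$ denote arbitrary integers, $\overline a_1,\overline a_2$ denote their classes in the respective factors, and the values of $q_2$ are taken modulo $2\mathbb Z$: (i) for some integer $k\ge 1$ and some odd integers $\theta_1,\theta_2$ with $\theta_1+\theta_2\equiv 0\pmod 4$, there is an isomorphism $A_2\cong(\mathbb Z/2^k\mathbb Z)\oplus(\mathbb Z/2^k\mathbb Z)$ under which $$q_2(\overline a_1,\overline a_2)=\frac{\theta_1a_1^2}{2^k}+\frac{\theta_2a_2^2}{2^k};$$ (ii) for some integer $k\ge 1$ and some odd integers $\theta_1,\theta_2$ with $\theta_1+\theta_2\equiv 0\pmod 4$, there is an isomorphism $A_2\cong(\mathbb Z/2^k\mathbb Z)\oplus(\mathbb Z/2^{k+1}\mathbb Z)$ under which $$q_2(\overline a_1,\overline a_2)=\frac{\theta_1a_1^2}{2^k}+\frac{\theta_2a_2^2}{2^{k+1}};$$ (iii) for some integer $k\ge 0$ and some odd integer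 $\theta$, there is an isomorphism $A_2\cong(\mathbb Z/2^k\mathbb Z)\oplus(\mathbb Z/2^k\mathbb Z)$ under which $$q_2(\overline a_1,\overline a_2)=\frac{\theta a_1a_2}{2^{k-1}};$$ (iv) for some integer $k\ge 0$ and some odd integer $\theta$, there is an isomorphism $A_2\cong(\mathbb Z/2^k\mathbb Z)\oplus(\mathbb Z/2^k\mathbb Z)$ under which $$q_2(\overline a_1,\overline a_2)=\frac{\theta(a_1^2+a_1a_2+a_2^2)}{2^{k-1}}.$$ -/

import Mathlib

open Module
open scoped TensorProduct ComplexConjugate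

namespace AbelianSurface

noncomputable section

/-! ## Lattices and discriminant forms -/

section Lattice

variable {M M' : Type*} [AddCommGroup M] [AddCommGroup M']

/-- Two `ℤ`-modules with integral bilinear forms are isometric. -/
def Isometric (B : LinearMap.BilinForm ℤ M) (B' : LinearMap.BilinForm ℤ M') : Prop :=
  ∃ e : M ≃ₗ[ℤ] M', ∀ x y, B' (e x) (e y) = B x y

/-- The `ℚ`-bilinear extension of an integral bilinear form on `M` to `ℚ ⊗ M`. -/
def ratForm (B : LinearMap.BilinForm ℤ M) : LinearMap.BilinForm ℚ (ℚ ⊗[ℤ] M) :=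
  LinearMap.BilinForm.baseChange ℚ B

theorem ratForm_tmul (B : LinearMap.BilinForm ℤ M) (a b : ℚ) (x y : M) :
    ratForm B (a ⊗ₜ[ℤ] x) (b ⊗ₜ[ℤ] y) = a * b * (B x y : ℚ) := by
  have h : ratForm B (a ⊗ₜ[ℤ] x) (b ⊗ₜ[ℤ] y) = (B x y) • (a * b) := rfl
  rw [h, zsmul_eq_mul, mul_comm]

theorem ratForm_symm (B : LinearMap.BilinForm ℤ M) (hs : B.IsSymm) (x y : ℚ ⊗[ℤ] M) :
    ratForm B x y = ratForm B y x := by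
  induction x with
  | zero => simp
  | add x₁ x₂ h₁ h₂ => simp [h₁, h₂]
  | tmul a m =>
    induction y with
    | zero => simp
    | add y₁ y₂ h₁ h₂ => simp [h₁, h₂]
    | tmul b n =>
      rw [ratForm_tmul, ratForm_tmul, mul_comm a b, hs.eq n m]

/-- The natural map `M → ℚ ⊗ M`. -/
def toRat (M : Type*) [AddCommGroup M] : M →+ ℚ ⊗[ℤ] M where
  toFun m := 1 ⊗ₜ[ℤ] m
  map_zero' := TensorProduct.tmul_zero _ _
  map_add' := TensorProduct.tmul_add _

/-- The dual lattice `M^∨ = {x ∈ ℚ ⊗ M | x · m ∈ ℤ for all m ∈ M}`. -/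
def dualLattice (B : LinearMap.BilinForm ℤ M) : AddSubgroup (ℚ ⊗[ℤ] M) where
  carrier := {x | ∀ m : M, ∃ n : ℤ, ratForm B x (toRat M m) = n}
  zero_mem' := fun m => ⟨0, by simp⟩
  add_mem' := by
    intro x y hx hy m
    obtain ⟨a, ha⟩ := hx m
    obtain ⟨b, hb⟩ := hy m
    exact ⟨a + b, by simp [ha, hb]⟩
  neg_mem' := by
    intro x hx m
    obtain ⟨a, ha⟩ := hx m
    exact ⟨-a, by simp [ha]⟩

/-- The discriminant group `A = M^∨ / M`. -/
abbrev DiscGroup (B : LinearMap.BilinForm ℤ M) : Type _ :=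
  dualLattice B ⧸ (toRat M).range.addSubgroupOf (dualLattice B)

/-- For an even lattice, `x · x` modulo `2ℤ` depends only on the class of `x ∈ M^∨` modulo `M`. -/
theorem discForm_wellDefined (B : LinearMap.BilinForm ℤ M) (hs : B.IsSymm)
    (he : ∀ x, Even (B x x)) (x y : dualLattice B)
    (h : -x + y ∈ (toRat M).range.addSubgroupOf (dualLattice B)) :
    ((ratForm B (x : ℚ ⊗[ℤ] M) (x : ℚ ⊗[ℤ] M) : ℚ) : AddCircle (2 : ℚ)) =
      ((ratForm B (y : ℚ ⊗[ℤ] M) (y : ℚ ⊗[ℤ] M) : ℚ) : AddCircle (2 : ℚ)) := by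
  obtain ⟨m, hm⟩ := AddSubgroup.mem_addSubgroupOf.mp h
  have hxm : (y : ℚ ⊗[ℤ] M) = (x : ℚ ⊗[ℤ] M) + toRat M m := by
    rw [hm]; simp
  obtain ⟨n, hn⟩ := x.2 m
  obtain ⟨r, hr⟩ := he m
  have hmm : ratForm B (toRat M m) (toRat M m) = (B m m : ℚ) := by
    have := ratForm_tmul B 1 1 m m
    rw [one_mul, one_mul] at this
    exact this
  rw [eq_comm, ← sub_eq_zero, ← QuotientAddGroup.mk_sub, QuotientAddGroup.eq_zero_iff,
    AddSubgroup.mem_zmultiples_iff]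
  refine ⟨n + r, ?_⟩
  rw [hxm]
  simp only [map_add, LinearMap.add_apply, hmm, ratForm_symm B hs (toRat M m), hn, hr]
  push_cast
  simp only [zsmul_eq_mul]
  push_cast
  ring

/-- The discriminant form `q : A → ℚ/2ℤ`, `q(x + M) = x · x mod 2ℤ`, of an even lattice. -/
def discForm (B : LinearMap.BilinForm ℤ M) (hs : B.IsSymm) (he : ∀ x, Even (B x x)) :
    DiscGroup B → AddCircle (2 : ℚ) :=
  fun a => Quotient.liftOn' a
    (fun x => ((ratForm B (x : ℚ ⊗[ℤ] M) (x : ℚ ⊗[ℤ] M) : ℚ) : AddCircle (2 : ℚ)))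
    (fun x y h => discForm_wellDefined B hs he x y (QuotientAddGroup.leftRel_apply.mp h))

end Lattice

/-! ## Complex tori of dimension two

Throughout, `V` is a complex vector space of dimension two and `Λ ⊆ V` is a lattice; they represent
the complex torus `X = V / Λ`, and `Λ = H₁(X, ℤ)`. -/

section Torus

variable {V : Type*} [NormedAddCommGroup V] [NormedSpace ℂ V]

/-- `H²(X, ℤ) = ⋀² Hom(Λ, ℤ)`: the integral alternating `2`-forms on `Λ = H₁(X, ℤ)`. -/
abbrev H2 (Λ : Submodule ℤ V) : Type _ := Λ [⋀^Fin 2]→ₗ[ℤ] ℤ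

/-- `H⁴(X, ℤ) = ⋀⁴ Hom(Λ, ℤ)`: the integral alternating `4`-forms on `Λ = H₁(X, ℤ)`. -/
abbrev H4 (Λ : Submodule ℤ V) : Type _ := Λ [⋀^Fin 4]→ₗ[ℤ] ℤ

/-- The cup product `H²(X, ℤ) × H²(X, ℤ) → H⁴(X, ℤ)`, i.e. the wedge product of alternating
forms (the signed sum over shuffles). -/
def cup {Λ : Submodule ℤ V} (E F : H2 Λ) : H4 Λ :=
  ((LinearMap.mul' ℤ ℤ).compAlternatingMap (E.domCoprod F)).domDomCongr finSumFinEquiv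

theorem sum_perm_four (g : Fin 4 → Fin 4 → Fin 4 → Fin 4 → ℤ) :
    ∑ σ : Equiv.Perm (Fin 4), (Equiv.Perm.sign σ : ℤ) * g (σ 0) (σ 1) (σ 2) (σ 3) =
    g 0 1 2 3 - g 0 1 3 2 - g 0 2 1 3 + g 0 2 3 1 + g 0 3 1 2 - g 0 3 2 1
    - g 1 0 2 3 + g 1 0 3 2 + g 1 2 0 3 - g 1 2 3 0 - g 1 3 0 2 + g 1 3 2 0
    + g 2 0 1 3 - g 2 0 3 1 - g 2 1 0 3 + g 2 1 3 0 + g 2 3 0 1 - g 2 3 1 0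
    - g 3 0 1 2 + g 3 0 2 1 + g 3 1 0 2 - g 3 1 2 0 - g 3 2 0 1 + g 3 2 1 0 := by
  have key : (Finset.univ : Finset (Equiv.Perm (Fin 4))).val.map
      (fun σ => ((Equiv.Perm.sign σ : ℤ), σ 0, σ 1, σ 2, σ 3)) =
      {(1, 0, 1, 2, 3), (-1, 0, 1, 3, 2), (-1, 0, 2, 1, 3), (1, 0, 2, 3, 1), (1, 0, 3, 1, 2),
       (-1, 0, 3, 2, 1), (-1, 1, 0, 2, 3), (1, 1, 0, 3, 2), (1, 1, 2, 0, 3), (-1, 1, 2, 3, 0),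
       (-1, 1, 3, 0, 2), (1, 1, 3, 2, 0), (1, 2, 0, 1, 3), (-1, 2, 0, 3, 1), (-1, 2, 1, 0, 3),
       (1, 2, 1, 3, 0), (1, 2, 3, 0, 1), (-1, 2, 3, 1, 0), (-1, 3, 0, 1, 2), (1, 3, 0, 2, 1),
       (1, 3, 1, 0, 2), (-1, 3, 1, 2, 0), (-1, 3, 2, 0, 1), (1, 3, 2, 1, 0)} := by
    decide +kernel
  have h := congrArg (fun s => (s.map (fun t : ℤ × Fin 4 × Fin 4 × Fin 4 × Fin 4 =>
    t.1 * g t.2.1 t.2.2.1 t.2.2.2.1 t.2.2.2.2)).sum) key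
  simp only [Multiset.map_map, Function.comp_def] at h
  refine h.trans ?_
  simp
  ring

set_option linter.unusedSectionVars false in
theorem cup_apply {Λ : Submodule ℤ V} (E F : H2 Λ) (v : Fin 4 → Λ) :
    cup E F v =
      E ![v 0, v 1] * F ![v 2, v 3] - E ![v 0, v 2] * F ![v 1, v 3]
        + E ![v 0, v 3] * F ![v 1, v 2] + E ![v 1, v 2] * F ![v 0, v 3]
        - E ![v 1, v 3] * F ![v 0, v 2] + E ![v 2, v 3] * F ![v 0, v 1] := by
  have key := MultilinearMap.domCoprod_alternization_eq E F
  have h := congrArg (fun f => LinearMap.mul' ℤ ℤ (f (v ∘ finSumFinEquiv))) key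
  simp only [MultilinearMap.alternatization_apply, Fintype.card_fin, AlternatingMap.smul_apply,
    map_sum, map_nsmul, MultilinearMap.domDomCongr_apply, MultilinearMap.domCoprod_apply,
    AlternatingMap.coe_multilinearMap] at h
  rw [← (Equiv.permCongr (finSumFinEquiv (m := 2) (n := 2)).symm).sum_comp] at h
  have hvec : ∀ w : Fin 2 → Λ, w = ![w 0, w 1] := fun w => by
    ext i; fin_cases i <;> rfl
  have hc := sum_perm_four (fun i j k l => E ![v i, v j] * F ![v k, v l])
  have hE : ∀ (G : H2 Λ) (x y : Λ), G ![y, x] = - G ![x, y] := by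
    intro G x y
    have := G.map_swap ![x, y] (show (0 : Fin 2) ≠ 1 by decide)
    rw [← this]
    congr 1
    ext i; fin_cases i <;> rfl
  have h2 : ∀ σ : Equiv.Perm (Fin 4), (LinearMap.mul' ℤ ℤ)
        (Equiv.Perm.sign ((finSumFinEquiv (m := 2) (n := 2)).symm.permCongr σ) •
          (E fun i₁ => (v ∘ ⇑finSumFinEquiv) (((finSumFinEquiv (m := 2) (n := 2)).symm.permCongr σ) (Sum.inl i₁))) ⊗ₜ[ℤ]
            F fun i₂ => (v ∘ ⇑finSumFinEquiv) (((finSumFinEquiv (m := 2) (n := 2)).symm.permCongr σ) (Sum.inr i₂))) =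
      (Equiv.Perm.sign σ : ℤ) * (E ![v (σ 0), v (σ 1)] * F ![v (σ 2), v (σ 3)]) := by
    intro σ
    rw [hvec (fun i₁ => (v ∘ ⇑finSumFinEquiv) (((finSumFinEquiv (m := 2) (n := 2)).symm.permCongr σ) (Sum.inl i₁))),
      hvec (fun i₁ => (v ∘ ⇑finSumFinEquiv) (((finSumFinEquiv (m := 2) (n := 2)).symm.permCongr σ) (Sum.inr i₁))),
      Equiv.Perm.sign_permCongr, Units.smul_def, map_zsmul, LinearMap.mul'_apply, smul_eq_mul]
    simp [Equiv.permCongr_apply]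
    rfl
  rw [Finset.sum_congr rfl (fun σ _ => h2 σ), hc] at h
  simp only [Nat.factorial, nsmul_eq_mul] at h
  change (LinearMap.mul' ℤ ℤ) ((E.domCoprod F) (v ∘ finSumFinEquiv)) = _
  push_cast at h
  simp only [hE E (v 0) (v 1), hE E (v 0) (v 2), hE E (v 0) (v 3), hE E (v 1) (v 2),
    hE E (v 1) (v 3), hE E (v 2) (v 3),
    hE F (v 0) (v 1), hE F (v 0) (v 2), hE F (v 0) (v 3), hE F (v 1) (v 2),
    hE F (v 1) (v 3), hE F (v 2) (v 3)] at h
  linarith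

/-- For a complex basis `c` of `V` with coordinates `z₁, z₂`, the determinant of four vectors
with respect to the real coordinates `Re z₁, Im z₁, Re z₂, Im z₂`. -/
def realDet (c : Basis (Fin 2) ℂ V) (v : Fin 4 → V) : ℝ :=
  Matrix.det (Matrix.of fun k : Fin 4 =>
    ![(c.repr (v k) 0).re, (c.repr (v k) 0).im, (c.repr (v k) 1).re, (c.repr (v k) 1).im])

/-- A basis of `Λ` is oriented if it is positive for the orientation of `V` as a complex vector
space. -/
def IsOriented {Λ : Submodule ℤ V} (b : Basis (Fin 4) ℤ Λ) : Prop :=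
  ∃ c : Basis (Fin 2) ℂ V, 0 < realDet c (fun k => (b k : V))

theorem realDet_change (c : Basis (Fin 2) ℂ V) (P : Matrix (Fin 4) (Fin 4) ℝ)
    (v w : Fin 4 → V) (h : ∀ k, w k = ∑ j, P k j • v j) :
    realDet c w = P.det * realDet c v := by
  rw [realDet, realDet, ← Matrix.det_mul]
  congr 1
  ext k i
  have hre : ∀ l, (c.repr (w k) l).re = ∑ j, P k j * (c.repr (v j) l).re := by
    intro l
    rw [h k]
    simp [← Complex.coe_smul]
  have him : ∀ l, (c.repr (w k) l).im = ∑ j, P k j * (c.repr (v j) l).im := by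
    intro l
    rw [h k]
    simp [← Complex.coe_smul]
  fin_cases i <;> simp [Matrix.mul_apply, hre, him]

theorem realDet_basis_change (c c' : Basis (Fin 2) ℂ V) (v : Fin 4 → V) :
    realDet c' v = Complex.normSq (c'.toMatrix c).det * realDet c v := by
  have h : ∀ k l, c'.repr (v k) l =
      c'.repr (c 0) l * c.repr (v k) 0 + c'.repr (c 1) l * c.repr (v k) 1 := by
    intro k l
    conv_lhs => rw [← c.sum_repr (v k), Fin.sum_univ_two]
    simp [mul_comm]
  simp only [realDet, h, Matrix.det_fin_two, Basis.toMatrix_apply, Complex.normSq_apply]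
  simp [Matrix.det_succ_row_zero, Fin.sum_univ_succ, Fin.succAbove]
  ring

theorem exists_isOriented [Fact (finrank ℂ V = 2)] (Λ : Submodule ℤ V)
    [DiscreteTopology Λ] [IsZLattice ℝ Λ] : ∃ b : Basis (Fin 4) ℤ Λ, IsOriented b := by
  have h2 : finrank ℂ V = 2 := Fact.out
  have : FiniteDimensional ℂ V := FiniteDimensional.of_finrank_pos (by omega)
  have : FiniteDimensional ℝ V := FiniteDimensional.complexToReal V
  have : Module.Free ℤ Λ := ZLattice.module_free ℝ Λ
  have : Module.Finite ℤ Λ := ZLattice.module_finite ℝ Λ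
  have h4 : finrank ℤ Λ = 4 := by
    rw [ZLattice.rank ℝ Λ, finrank_real_of_complex, h2]
  let b : Basis (Fin 4) ℤ Λ := finBasisOfFinrankEq ℤ Λ h4
  let c : Basis (Fin 2) ℂ V := finBasisOfFinrankEq ℂ V h2
  have hne : realDet c (fun k => (b k : V)) ≠ 0 := by
    let r : Basis (Fin 4) ℝ V := b.ofZLatticeBasis ℝ Λ
    let f : Fin 4 → V := ![c 0, Complex.I • c 0, c 1, Complex.I • c 1]
    have h := realDet_change c (Matrix.of fun k j => r.repr (f k) j) (fun k => (b k : V)) f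
      (fun k => by
        conv_lhs => rw [← r.sum_repr (f k)]
        exact Finset.sum_congr rfl fun j _ => by
          rw [Matrix.of_apply, Basis.ofZLatticeBasis_apply])
    have h1 : realDet c f = 1 := by
      simp [realDet, f, Matrix.det_succ_row_zero, Fin.sum_univ_succ, Fin.succAbove]
    intro h0
    rw [h0, h1, mul_zero] at h
    exact one_ne_zero h
  rcases lt_or_gt_of_ne hne with hlt | hgt
  · refine ⟨b.unitsSMul ![-1, 1, 1, 1], c, ?_⟩
    have h := realDet_change c (Matrix.diagonal ![-1, 1, 1, 1]) (fun k => (b k : V))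
      (fun k => (b.unitsSMul ![-1, 1, 1, 1] k : V)) (fun k => by
        fin_cases k <;> simp [Basis.unitsSMul_apply, Matrix.diagonal_apply])
    rw [h]
    simp [Matrix.det_diagonal, Fin.prod_univ_four]
    exact hlt
  · exact ⟨b, c, hgt⟩

section

variable [Fact (finrank ℂ V = 2)] (Λ : Submodule ℤ V) [DiscreteTopology Λ] [IsZLattice ℝ Λ]

/-- The isomorphism `H⁴(X, ℤ) ≅ ℤ` given by the complex orientation of `X`: evaluation on an
oriented basis of `Λ`. -/
def degree : H4 Λ → ℤ := fun ω => ω (exists_isOriented Λ).choose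

/-- The degree does not depend on the oriented basis. -/
theorem degree_eq (ω : H4 Λ) (b : Basis (Fin 4) ℤ Λ) (hb : IsOriented b) :
    degree Λ ω = ω b := by
  obtain ⟨c, hc⟩ := hb
  obtain ⟨c', hc'⟩ := (exists_isOriented Λ).choose_spec
  set b' := (exists_isOriented Λ).choose with hb'
  have hch := realDet_change c ((b.toMatrix b').transpose.map (Int.cast : ℤ → ℝ))
    (fun k => (b k : V)) (fun k => (b' k : V)) (fun k => by
      conv_lhs => rw [← b.sum_repr (b' k)]
      push_cast
      exact Finset.sum_congr rfl fun j _ => by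
        simp [Basis.toMatrix_apply, Int.cast_smul_eq_zsmul])
  rw [realDet_basis_change c c'] at hc'
  have hdet : ((b.toMatrix b').transpose.map (Int.cast : ℤ → ℝ)).det = (b.det b' : ℝ) := by
    rw [Basis.det_apply, ← Matrix.det_transpose (b.toMatrix b')]
    exact ((Int.castRingHom ℝ).map_det _).symm
  rw [hdet] at hch
  have hpos : 0 < realDet c (fun k => (b' k : V)) :=
    pos_of_mul_pos_right hc' (Complex.normSq_nonneg _)
  have hd : (0 : ℝ) < (b.det b' : ℝ) := by
    rw [hch] at hpos
    exact pos_of_mul_pos_left hpos hc.le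
  have hd1 : b.det b' = 1 := by
    have hu := b.isUnit_det b'
    rcases Int.isUnit_iff.mp hu with h | h
    · exact h
    · rw [h] at hd; norm_num at hd
  have h := ω.eq_smul_basis_det b
  change ω b' = ω b
  conv_lhs => rw [h]
  simp [hd1]

/-- The intersection form `H²(X, ℤ) × H²(X, ℤ) → H⁴(X, ℤ) ≅ ℤ`. -/
def intersectionForm : LinearMap.BilinForm ℤ (H2 Λ) :=
  LinearMap.mk₂ ℤ (fun E F => degree Λ (cup E F))
    (fun E E' F => by simp only [degree, cup_apply, AlternatingMap.add_apply]; ring)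
    (fun n E F => by simp only [degree, cup_apply, AlternatingMap.smul_apply, smul_eq_mul]; ring)
    (fun E F F' => by simp only [degree, cup_apply, AlternatingMap.add_apply]; ring)
    (fun n E F => by simp only [degree, cup_apply, AlternatingMap.smul_apply, smul_eq_mul]; ring)

theorem intersectionForm_isSymm : (intersectionForm Λ).IsSymm :=
  ⟨fun E F => by
    simp only [intersectionForm, LinearMap.mk₂_apply, degree, cup_apply]; ring⟩

theorem intersectionForm_even (E : H2 Λ) : Even (intersectionForm Λ E E) := by
  have h : ∀ a b c d e f : ℤ, Even (a * b - c * d + e * f + f * e - d * c + b * a) :=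
    fun a b c d e f => ⟨a * b - c * d + e * f, by ring⟩
  simp only [intersectionForm, LinearMap.mk₂_apply, degree, cup_apply]
  exact h _ _ _ _ _ _

end

/-! ### Abelian surfaces, Néron-Severi lattices -/

/-- A sesquilinear form (linear in the first variable) is Hermitian. -/
def IsHermitian (H : V →ₗ[ℂ] V →ₗ⋆[ℂ] ℂ) : Prop := ∀ x y, H y x = conj (H x y)

/-- The complex torus `V / Λ` is an abelian variety (i.e. projective) if it carries a
polarization: a positive definite Hermitian form whose imaginary part is integral on `Λ`. -/
def IsAbelian (Λ : Submodule ℤ V) : Prop :=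
  ∃ H : V →ₗ[ℂ] V →ₗ⋆[ℂ] ℂ, IsHermitian H ∧ (∀ x, x ≠ 0 → 0 < (H x x).re) ∧
    ∀ x y : Λ, ∃ n : ℤ, (H x y).im = n

/-- The Néron-Severi group `NS(X) ⊆ H²(X, ℤ)`: the first Chern classes of holomorphic line bundles,
i.e. the integral classes of type `(1,1)`. These are the integral alternating forms on `Λ` that are
the imaginary part of a Hermitian form on `V`. -/
def NS (Λ : Submodule ℤ V) : Submodule ℤ (H2 Λ) where
  carrier := {E | ∃ H : V →ₗ[ℂ] V →ₗ⋆[ℂ] ℂ, IsHermitian H ∧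
    ∀ x y : Λ, (H x y).im = E ![x, y]}
  zero_mem' := ⟨0, fun x y => by simp, fun x y => by simp⟩
  add_mem' := by
    rintro E F ⟨H, hH, hE⟩ ⟨K, hK, hF⟩
    exact ⟨H + K, fun x y => by simp [hH x y, hK x y], fun x y => by simp [hE, hF]⟩
  smul_mem' := by
    rintro n E ⟨H, hH, hE⟩
    exact ⟨(n : ℂ) • H, fun x y => by simp [hH x y], fun x y => by simp [hE]⟩

/-- The Picard number `ρ(X)`, the rank of `NS(X)`. -/
def picardNumber (Λ : Submodule ℤ V) : ℕ := finrank ℤ (NS Λ)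

section

variable [Fact (finrank ℂ V = 2)] (Λ : Submodule ℤ V) [DiscreteTopology Λ] [IsZLattice ℝ Λ]

/-- The intersection form on `NS(X)`. -/
def nsForm : LinearMap.BilinForm ℤ (NS Λ) := (intersectionForm Λ).restrict (NS Λ)

theorem nsForm_isSymm : (nsForm Λ).IsSymm := (intersectionForm_isSymm Λ).restrict (NS Λ)

theorem nsForm_even (D : NS Λ) : Even (nsForm Λ D D) := intersectionForm_even Λ D

/-- The transcendental lattice `T(X) = NS(X)^⊥ ⊆ H²(X, ℤ)`. -/
def transLattice : Submodule ℤ (H2 Λ) := (intersectionForm Λ).orthogonal (NS Λ)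

/-- The intersection form on `T(X)`. -/
def transForm : LinearMap.BilinForm ℤ (transLattice Λ) := (intersectionForm Λ).restrict (transLattice Λ)

/-- The Mukai pairing `(r, D, s) · (r', D', s') = D · D' - r s' - s r'` on
`Hᵉᵛ(X, ℤ) = H⁰(X, ℤ) ⊕ H²(X, ℤ) ⊕ H⁴(X, ℤ)`, where `H⁰(X, ℤ) = ℤ` and `H⁴(X, ℤ) ≅ ℤ`. -/
def mukaiForm : LinearMap.BilinForm ℤ (ℤ × H2 Λ × ℤ) :=
  LinearMap.mk₂ ℤ
    (fun x y => intersectionForm Λ x.2.1 y.2.1 - x.1 * y.2.2 - x.2.2 * y.1)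
    (fun x x' y => by simp; ring) (fun n x y => by simp; ring)
    (fun x y y' => by simp; ring) (fun n x y => by simp; ring)

/-- The numerical Grothendieck group `N(X) = H⁰(X, ℤ) ⊕ NS(X) ⊕ H⁴(X, ℤ)`. -/
def numGroup : Submodule ℤ (ℤ × H2 Λ × ℤ) := Submodule.prod ⊤ (Submodule.prod (NS Λ) ⊤)

/-- The Mukai pairing on `N(X)`. -/
def numForm : LinearMap.BilinForm ℤ (numGroup Λ) := (mukaiForm Λ).restrict (numGroup Λ)

/-- `X` is self-mirror if `T(X)` and `N(X)` are isometric lattices. -/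
def IsSelfMirror : Prop := Isometric (transForm Λ) (numForm Λ)

/-- The discriminant group `A` of `NS(X)`. -/
abbrev discNS : Type _ := DiscGroup (nsForm Λ)

/-- The discriminant form `q : A → ℚ/2ℤ` of `NS(X)`. -/
def qNS : discNS Λ → AddCircle (2 : ℚ) := discForm (nsForm Λ) (nsForm_isSymm Λ) (nsForm_even Λ)

/-- The `p`-Sylow subgroup `A_p ⊆ A`. -/
abbrev sylowDiscNS (p : ℕ) : AddSubgroup (discNS Λ) := AddCommGroup.primaryComponent (discNS Λ) p

end

end Torus

end

end AbelianSurface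

open AbelianSurface

namespace AbelianSurface

/-! Let `U` be the hyperbolic plane and let `f = A x² + B x y + C y²` be half the norm form of
`NS(X)`. The intersection form is twice a Pfaffian, so `H²(X, ℤ)` is `U³` (`h2Equiv`,
`intersectionForm_self`). `NS(X)` is saturated of rank two, and automorphisms of `U³` move every
saturated sublattice of rank two to the span of `((1, a), 0, 0)` and `((0, b), (1, c), 0)`
(`exists_normal_form`). There the orthogonal complement is visibly `-f ⊕ U`, while the Mukai lattice
`N(X)` is `f ⊕ U`. Hence `X` is self-mirror iff `-f ⊕ U` and `f ⊕ U` are isometric.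

Write `f = g f₀` with `f₀` primitive of discriminant `D`; the Hodge index theorem gives `D > 0`
(`discr_pos`). The arithmetic core is `isometric_neg_plane_iff`: the isometry exists iff no prime
congruent to `3` modulo `4` divides `D` and `16` does not divide `D`. Necessity: an isometry
preserves the vectors whose pairings are all divisible by `gD`. Comparing their norms shows that for
every value of `f₀` the opposite is a value modulo `D`. The identity `4 f₀(s,t) f₀(x,y) = N² - D (sy
- tx)²`, with `N` the polar form, then makes `-1` a square modulo any odd prime dividing `D`, and
modulo `4` if `16 ∣ D`. Sufficiency: with `d = D/4` or `d = D`, `d` is a sum of two coprime squares,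
which gives `p² - d q² = -n²`. Multiplication by `p + q√d` scales `f` by `-n²`, and the plane `U`
absorbs the denominator `n` (`isometric_neg_plane`).

Finally `D` is read off from the discriminant form. For odd `p` the Sylow subgroup is `ℤ/p^k ×
ℤ/p^(k+e)` with `k = v_p(g)` and `e = v_p(D)`, so (a) says that `p ∤ D`. For `p = 2` and `D` even
the form is diagonal on `ℤ/2^k × ℤ/2^(k+e)` with `k = v₂(2g)` and `e = v₂(D/4)`; the cases `e = 0,
1` are (i) and (ii), and the congruence on `θ₁ + θ₂` comes from (a), which forces the odd part of
`D/4` to be `1` modulo `4`. If `D` is odd, the form is a multiple of a hyperbolic or an anisotropic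
plane over the `2`-adic integers: (iii) and (iv). -/

/-! ### Explicit isometries from `-f ⊕ U` to `f ⊕ U`. -/

/-- The Gram matrix of the orthogonal sum of the binary form `A x² + B x y + C y²` and a hyperbolic
plane. -/
def planeGram (A B C : ℤ) : Matrix (Fin 4) (Fin 4) ℤ :=
  !![2 * A, B, 0, 0; B, 2 * C, 0, 0; 0, 0, 0, 1; 0, 0, 1, 0]

theorem det_planeGram (A B C : ℤ) : (planeGram A B C).det = B ^ 2 - 4 * A * C := by
  simp [planeGram, Matrix.det_succ_row_zero, Fin.sum_univ_succ, Fin.succAbove]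
  ring

/-- Equal nonzero determinants force `det P = ±1`, so a Gram matrix identity is already an isometry.
-/
theorem isometric_of_gram {n : Type*} [Fintype n] [DecidableEq n] {G G' P : Matrix n n ℤ}
    (h : P.transpose * G' * P = G) (hdet : G.det = G'.det) (h0 : G.det ≠ 0) :
    Isometric (Matrix.toBilin' G) (Matrix.toBilin' G') := by
  have hP : P.det ^ 2 = 1 := by
    have := congrArg Matrix.det h
    rw [Matrix.det_mul, Matrix.det_mul, Matrix.det_transpose, ← hdet] at this
    have h2 : G.det * (P.det ^ 2 - 1) = 0 := by linear_combination this
    rcases mul_eq_zero.mp h2 with h3 | h3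
    · exact absurd h3 h0
    · linarith
  have hu : IsUnit (LinearMap.toMatrix (Pi.basisFun ℤ n) (Pi.basisFun ℤ n)
      (Matrix.toLin' P)).det := by
    change IsUnit (LinearMap.toMatrix' (Matrix.toLin' P)).det
    rw [LinearMap.toMatrix'_toLin']
    exact IsUnit.of_pow_eq_one hP two_ne_zero
  refine ⟨LinearEquiv.ofIsUnitDet hu, fun x y => ?_⟩
  simp only [LinearEquiv.ofIsUnitDet_apply, Matrix.toBilin'_apply', Matrix.toLin'_apply, ← h]
  simp only [Matrix.mulVec_mulVec, Matrix.dotProduct_mulVec, Matrix.vecMul_mulVec,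
    Matrix.mul_assoc]


/-- The matrix with columns `(p - qβ, qα)` and `(-qγ, p + qβ)` is multiplication by `p + q√d`; it
multiplies the binary form by `p² - d q² = -n²`, so divided by `n` it is a rational isometry from
`-f` to `f`. The Bézout coefficients `k, l` glue it integrally to the hyperbolic plane: for instance
the first column of `P` has norm `-2A (ln + 2Akp)² = -2A`. -/
theorem isometric_neg_plane {A B C μ α β γ d p q n k l : ℤ} (hA : 2 * A = μ * α) (hB : B = μ * β)
    (hC : 2 * C = μ * γ) (hd : d = β ^ 2 - α * γ) (hn : p ^ 2 + n ^ 2 = d * q ^ 2)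
    (hkl : k * (2 * A * p) + l * n = 1) (h0 : B ^ 2 - 4 * A * C ≠ 0) :
    Isometric (Matrix.toBilin' (planeGram (-A) (-B) (-C))) (Matrix.toBilin' (planeGram A B C)) := by
  refine isometric_of_gram (P :=
    !![l * (p - q * β), -l * q * γ + n * k * B, k * (p - q * β), k * A * (p + q * β) + l * n;
       l * (q * α), l * p + l * q * β - 2 * k * A * n, k * (q * α), -k * A * q * α;
       2 * A * p, -2 * A * q * γ + B * (p + q * β), -n, n * A;
       -(2 * A * k * (k * A * p + l * n)),
       -(k * (k * A * (2 * A * q * γ + B * (p - q * β)) + l * n * B)), -(n * k ^ 2 * A),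
       -(-k ^ 2 * A ^ 2 * n + 2 * p * l * k * A + l ^ 2 * n)]) ?_ ?_ ?_
  · subst hB hd
    ext i j
    fin_cases i <;> fin_cases j <;> simp [planeGram, Matrix.mul_apply, Fin.sum_univ_succ]
    all_goals grind
  · rw [det_planeGram, det_planeGram]; ring
  · rw [det_planeGram]
    intro h; apply h0; linarith

/-! ### Coprime sums of two squares and the equation `p² + n² = d q²`. -/

theorem isCoprime_of_forall_prime {x y : ℤ}
    (h : ∀ p : ℕ, p.Prime → (p : ℤ) ∣ x → (p : ℤ) ∣ y → False) : IsCoprime x y := by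
  rw [Int.isCoprime_iff_gcd_eq_one]
  by_contra hne
  obtain ⟨p, hp, hpd⟩ := Nat.exists_prime_and_dvd hne
  exact h p hp ((Int.natCast_dvd_natCast.mpr hpd).trans (Int.gcd_dvd_left ..))
    ((Int.natCast_dvd_natCast.mpr hpd).trans (Int.gcd_dvd_right ..))

/-- The product of a coprime sum of two squares and of a prime that is a sum of two squares. -/
theorem exists_coprime_sq_add_sq_mul {p : ℕ} (hp : p.Prime) (hp2 : p ≠ 2) {x y r s : ℤ}
    (hxy : (p : ℤ) = x ^ 2 + y ^ 2) (hrs : IsCoprime r s) :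
    ∃ r' s' : ℤ, (p : ℤ) * (r ^ 2 + s ^ 2) = r' ^ 2 + s' ^ 2 ∧ IsCoprime r' s' := by
  have hpp : Prime (p : ℤ) := Nat.prime_iff_prime_int.mp hp
  have hp0 : (0 : ℤ) < p := by exact_mod_cast hp.pos
  have hsq : ∀ z : ℤ, (p : ℤ) ≠ z ^ 2 := by
    intro z hz
    exact hpp.irreducible.not_isSquare ⟨z, by rw [hz]; ring⟩
  have hpx : ¬ (p : ℤ) ∣ x := by
    rintro ⟨c, rfl⟩
    rcases eq_or_ne c 0 with rfl | hc
    · exact hsq y (by linarith)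
    · have : 1 ≤ c ^ 2 := by have := sq_nonneg c; have : c ^ 2 ≠ 0 := pow_ne_zero 2 hc; omega
      have h1 : (p : ℤ) ^ 2 ≤ (p * c) ^ 2 := by nlinarith
      have h2 : (2 : ℤ) ≤ p := by exact_mod_cast hp.two_le
      have h3 : (p : ℤ) < p ^ 2 := by nlinarith
      nlinarith [sq_nonneg y]
  have hp2' : ¬ (p : ℤ) ∣ 2 := by
    intro h
    exact hp2 ((Nat.prime_dvd_prime_iff_eq hp Nat.prime_two).mp (by exact_mod_cast h))
  -- The signs `ε = ±1` are the two Gaussian products of `r + is` with `x ± iy`. A prime dividing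
  -- both components divides `pr` and `ps`, so only `p` itself can obstruct coprimality; if it did
  -- for both signs, it would divide `r` and `s`.
  have key : ∀ ε : ℤ, ε ^ 2 = 1 → ¬ ((p : ℤ) ∣ r * x - ε * (s * y) ∧ (p : ℤ) ∣ r * y + ε * (s * x)) →
      IsCoprime (r * x - ε * (s * y)) (r * y + ε * (s * x)) := by
    intro ε hε hnd
    rw [Int.isCoprime_iff_gcd_eq_one]
    by_contra hne
    obtain ⟨l, hl, hld⟩ := Nat.exists_prime_and_dvd hne
    have h1 : (l : ℤ) ∣ r * x - ε * (s * y) :=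
      (Int.natCast_dvd_natCast.mpr hld).trans (Int.gcd_dvd_left ..)
    have h2 : (l : ℤ) ∣ r * y + ε * (s * x) :=
      (Int.natCast_dvd_natCast.mpr hld).trans (Int.gcd_dvd_right ..)
    have h3 : (l : ℤ) ∣ p * r := by
      exact (dvd_add (h1.mul_right x) (h2.mul_right y)).trans (dvd_of_eq (by rw [hxy]; ring))
    have h4 : (l : ℤ) ∣ p * s := by
      exact (dvd_sub (h2.mul_right (ε * x)) (h1.mul_right (ε * y))).trans
        (dvd_of_eq (by rw [hxy]; linear_combination (s * x ^ 2 + s * y ^ 2) * hε))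
    have hlp : (l : ℤ) ∣ p := by
      obtain ⟨u, v, huv⟩ := hrs
      exact (dvd_add (h3.mul_right u) (h4.mul_right v)).trans
        (dvd_of_eq (by linear_combination (p : ℤ) * huv))
    have : l = p := (Nat.prime_dvd_prime_iff_eq hl hp).mp (by exact_mod_cast hlp)
    subst this
    exact hnd ⟨h1, h2⟩
  by_cases h : (p : ℤ) ∣ r * x - 1 * (s * y) ∧ (p : ℤ) ∣ r * y + 1 * (s * x)
  · refine ⟨_, _, ?_, key (-1) (by norm_num) ?_⟩
    · rw [hxy]; ring
    · rintro ⟨h1, h2⟩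
      have hr : (p : ℤ) ∣ r := by
        have : (p : ℤ) ∣ (2 * x) * r :=
          (dvd_add h.1 h1).trans (dvd_of_eq (by ring))
        rcases hpp.dvd_or_dvd this with h' | h'
        · rcases hpp.dvd_or_dvd h' with h'' | h''
          · exact absurd h'' hp2'
          · exact absurd h'' hpx
        · exact h'
      have hs : (p : ℤ) ∣ s := by
        have : (p : ℤ) ∣ (2 * x) * s :=
          (dvd_sub h.2 h2).trans (dvd_of_eq (by ring))
        rcases hpp.dvd_or_dvd this with h' | h'
        · rcases hpp.dvd_or_dvd h' with h'' | h''
          · exact absurd h'' hp2'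
          · exact absurd h'' hpx
        · exact h'
      exact hpp.not_isUnit (hrs.isUnit_of_dvd' hr hs)
  · refine ⟨_, _, ?_, key 1 (by norm_num) h⟩
    rw [hxy]; ring

/-- An odd number without prime factors congruent to `3` modulo `4` is a sum of two coprime
squares. -/
theorem exists_coprime_sq_add_sq_of_odd (d : ℕ) (hd : d ≠ 0)
    (h : ∀ p : ℕ, p.Prime → p ∣ d → p % 4 = 1) :
    ∃ r s : ℤ, (d : ℤ) = r ^ 2 + s ^ 2 ∧ IsCoprime r s := by
  induction d using induction_on_primes with
  | zero => exact absurd rfl hd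
  | one => exact ⟨1, 0, by norm_num, isCoprime_one_left⟩
  | prime_mul p a hp ih =>
    obtain ⟨r, s, hrs, hc⟩ := ih (right_ne_zero_of_mul hd) fun q hq hqa => h q hq (hqa.mul_left p)
    have hp1 := h p hp (dvd_mul_right p a)
    have := Fact.mk hp
    obtain ⟨x, y, hxy⟩ := Nat.Prime.sq_add_sq (p := p) (by omega)
    obtain ⟨r', s', h1, h2⟩ := exists_coprime_sq_add_sq_mul hp (by rintro rfl; omega)
      (x := x) (y := y) (by exact_mod_cast hxy.symm) hc
    exact ⟨r', s', by rw [← h1, ← hrs]; push_cast; ring, h2⟩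

/-- A positive number without prime factors congruent to `3` modulo `4` and not divisible by `4` is
a sum of two coprime squares, the second one odd. -/
theorem exists_coprime_sq_add_sq {d : ℤ} (hd : 0 < d)
    (h : ∀ p : ℕ, p.Prime → p % 4 = 3 → ¬ (p : ℤ) ∣ d) (h4 : ¬ (4 : ℤ) ∣ d) :
    ∃ r s : ℤ, d = r ^ 2 + s ^ 2 ∧ IsCoprime r s ∧ Odd s := by
  suffices H : ∃ r s : ℤ, d = r ^ 2 + s ^ 2 ∧ IsCoprime r s by
    obtain ⟨r, s, h1, h2⟩ := H
    by_cases hs : Odd s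
    · exact ⟨r, s, h1, h2, hs⟩
    · refine ⟨s, r, by rw [h1]; ring, h2.symm, ?_⟩
      by_contra hr
      rw [Int.not_odd_iff_even] at hs hr
      have := h2.isUnit_of_dvd' hr.two_dvd hs.two_dvd
      exact absurd this (by decide)
  have odd_case : ∀ e : ℤ, 0 < e → e ∣ d → Odd e →
      ∃ r s : ℤ, e = r ^ 2 + s ^ 2 ∧ IsCoprime r s := by
    intro e he hed ho
    lift e to ℕ using he.le
    refine exists_coprime_sq_add_sq_of_odd e (by rintro rfl; simp at he) fun p hp hpe => ?_
    have h1 : p % 4 ≠ 3 := fun h3 => h p hp h3 ((Int.natCast_dvd_natCast.mpr hpe).trans hed)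
    have h2 : Odd p := Odd.of_dvd_nat (by exact_mod_cast ho) hpe
    rcases h2 with ⟨c, rfl⟩
    omega
  rcases Int.even_or_odd d with he | ho
  · obtain ⟨e, rfl⟩ := he.two_dvd
    have hoe : Odd e := by
      by_contra hne
      rw [Int.not_odd_iff_even] at hne
      obtain ⟨c, rfl⟩ := hne.two_dvd
      exact h4 ⟨c, by ring⟩
    obtain ⟨r, s, h1, h2⟩ := odd_case e (by omega) (dvd_mul_left e 2) hoe
    -- Multiplication by `1 + i`; the parity of `r + s` excludes the common factor `2`.
    refine ⟨r - s, r + s, by rw [h1]; ring, isCoprime_of_forall_prime fun p hp hp1 hp2 => ?_⟩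
    have hpp : Prime (p : ℤ) := Nat.prime_iff_prime_int.mp hp
    have hr : (p : ℤ) ∣ 2 * r := (dvd_add hp1 hp2).trans (dvd_of_eq (by ring))
    have hs : (p : ℤ) ∣ 2 * s := (dvd_sub hp2 hp1).trans (dvd_of_eq (by ring))
    by_cases hp' : (p : ℤ) ∣ 2
    · have : p = 2 := (Nat.prime_dvd_prime_iff_eq hp Nat.prime_two).mp (by exact_mod_cast hp')
      subst this
      have : Odd (r + s) := by
        rw [h1] at hoe
        simpa [Int.odd_add, Int.odd_pow, Int.even_pow] using hoe
      exact (Int.not_even_iff_odd.mpr this) (even_iff_two_dvd.mpr (by exact_mod_cast hp2))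
    · exact hpp.not_isUnit (h2.isUnit_of_dvd' ((hpp.dvd_or_dvd hr).resolve_left hp')
        ((hpp.dvd_or_dvd hs).resolve_left hp'))
  · exact odd_case d hd dvd_rfl ho

/-- With `d = r² + s²`, every `v` gives a solution `p + in = (r + is)(1 + iv)²`, `q = 1 + v²`. The
freedom in `v` is spent on making `n` prime to `2Md`; coprimality of `n` with `p` then follows from
that of `r` and `s`. -/
theorem exists_norm_eq_neg_sq {d M : ℤ} (hd : 0 < d)
    (h : ∀ p : ℕ, p.Prime → p % 4 = 3 → ¬ (p : ℤ) ∣ d) (h4 : ¬ (4 : ℤ) ∣ d) (hM : M ≠ 0) :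
    ∃ p q n : ℤ, p ^ 2 + n ^ 2 = d * q ^ 2 ∧ IsCoprime (2 * M * p) n := by
  obtain ⟨r, s, hrs, hc, hs⟩ := exists_coprime_sq_add_sq hd h h4
  have hM' : (2 * M * d).natAbs ≠ 0 := by
    rw [Int.natAbs_ne_zero]; positivity
  -- Modulo a prime `l ∣ 2Md`, `n = s(1 - v²) + 2rv` becomes `s ≠ 0` if `l ∤ s`, since then `l ∣ v`.
  -- If `l ∣ s` it becomes `2rv`, nonzero since `l` is odd, `l ∤ r` and `l ∤ v`.
  set v : ℤ := ((∏ p ∈ (2 * M * d).natAbs.primeFactors with ¬ ((p : ℕ) : ℤ) ∣ s, p : ℕ) : ℤ)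
    with hv
  have hn : ∀ p : ℕ, p.Prime → (p : ℤ) ∣ 2 * M * d → ¬ (p : ℤ) ∣ s * (1 - v ^ 2) + 2 * r * v := by
    intro p hp hpM hpn
    have hpp : Prime (p : ℤ) := Nat.prime_iff_prime_int.mp hp
    have hpf : p ∈ (2 * M * d).natAbs.primeFactors :=
      Nat.mem_primeFactors.mpr ⟨hp, Int.natCast_dvd.mp hpM, hM'⟩
    by_cases hps : (p : ℤ) ∣ s
    · have h1 : (p : ℤ) ∣ 2 * r * v := (dvd_sub hpn (hps.mul_right (1 - v ^ 2))).trans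
        (dvd_of_eq (by ring))
      rcases hpp.dvd_or_dvd h1 with h2 | h2
      · rcases hpp.dvd_or_dvd h2 with h3 | h3
        · have : p = 2 := (Nat.prime_dvd_prime_iff_eq hp Nat.prime_two).mp (by exact_mod_cast h3)
          subst this
          exact (Int.not_even_iff_odd.mpr hs) (even_iff_two_dvd.mpr (by exact_mod_cast hps))
        · exact hpp.not_isUnit (hc.isUnit_of_dvd' h3 hps)
      · rw [hv, Int.natCast_dvd_natCast, hp.prime.dvd_finsetProd_iff] at h2
        obtain ⟨l, hl, hpl⟩ := h2
        rw [Finset.mem_filter, Nat.mem_primeFactors] at hl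
        rw [Nat.prime_dvd_prime_iff_eq hp hl.1.1] at hpl
        exact hl.2 (hpl ▸ hps)
    · have h1 : (p : ℤ) ∣ v := by
        rw [hv, Int.natCast_dvd_natCast]
        exact Finset.dvd_prod_of_mem _ (Finset.mem_filter.mpr ⟨hpf, hps⟩)
      exact hps ((dvd_sub hpn (h1.mul_right (2 * r - s * v))).trans (dvd_of_eq (by ring)))
  refine ⟨r * (1 - v ^ 2) - 2 * s * v, 1 + v ^ 2, s * (1 - v ^ 2) + 2 * r * v, by rw [hrs]; ring,
    isCoprime_of_forall_prime fun p hp h1 h2 => ?_⟩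
  have hpp : Prime (p : ℤ) := Nat.prime_iff_prime_int.mp hp
  have h3 : ¬ (p : ℤ) ∣ 2 * M * d := fun h => hn p hp h h2
  rcases hpp.dvd_or_dvd h1 with h5 | h5
  · exact h3 (h5.mul_right d)
  have hpd : ¬ (p : ℤ) ∣ 2 * d := fun h => h3 ((h.mul_right M).trans (dvd_of_eq (by ring)))
  -- Multiplying by `r - is` isolates `d(1 + iv)²`. A common prime would divide `1 - v²` and `v`.
  have h6 : (p : ℤ) ∣ d * (1 - v ^ 2) := (dvd_add (h5.mul_right r) (h2.mul_right s)).trans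
    (dvd_of_eq (by rw [hrs]; ring))
  have h7 : (p : ℤ) ∣ 2 * d * v := (dvd_sub (h2.mul_right r) (h5.mul_right s)).trans
    (dvd_of_eq (by rw [hrs]; ring))
  have h8 := (hpp.dvd_or_dvd h7).resolve_left hpd
  have h9 := (hpp.dvd_or_dvd h6).resolve_left fun h => hpd (h.mul_left 2)
  exact hpp.not_isUnit (isUnit_of_dvd_one ((dvd_add h9 (h8.mul_right v)).trans
    (dvd_of_eq (by ring))))

/-! ### The arithmetic criterion for `-f ⊕ U ≅ f ⊕ U`. -/

/-- The sum of a binary form with a hyperbolic plane is isometric to its negative, if no prime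
congruent to `3` modulo `4` and no high power of two divides the discriminant of the primitive
part of the binary form. -/
theorem isometric_neg_plane_of_discr {g a b c : ℤ} (hga : g * a ≠ 0) (hD : 0 < b ^ 2 - 4 * a * c)
    (h : ∀ p : ℕ, p.Prime → p % 4 = 3 → ¬ (p : ℤ) ∣ b ^ 2 - 4 * a * c)
    (h16 : ¬ (16 : ℤ) ∣ b ^ 2 - 4 * a * c) :
    Isometric (Matrix.toBilin' (planeGram (-(g * a)) (-(g * b)) (-(g * c))))
      (Matrix.toBilin' (planeGram (g * a) (g * b) (g * c))) := by
  have h0 : (g * b) ^ 2 - 4 * (g * a) * (g * c) ≠ 0 := by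
    have : (g * b) ^ 2 - 4 * (g * a) * (g * c) = g ^ 2 * (b ^ 2 - 4 * a * c) := by ring
    rw [this]
    exact mul_ne_zero (pow_ne_zero 2 (left_ne_zero_of_mul hga)) hD.ne'
  rcases Int.even_or_odd b with hb | hb
  -- For even `b` the Gram matrix is divisible by `2g`, and the relevant norm form has `d = D/4`;
  -- for odd `b` it is only divisible by `g`, and `d = D` is odd.
  · obtain ⟨b', rfl⟩ := hb.two_dvd
    have hd : (2 * b') ^ 2 - 4 * a * c = 4 * (b' ^ 2 - a * c) := by ring
    rw [hd] at hD h h16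
    obtain ⟨p, q, n, h1, k, l, hkl⟩ := exists_norm_eq_neg_sq (d := b' ^ 2 - a * c) (M := g * a)
      (by omega) (fun p hp hp3 hpd => h p hp hp3 (hpd.mul_left 4))
      (fun h => h16 (by simpa using mul_dvd_mul_left 4 h)) hga
    exact isometric_neg_plane (μ := 2 * g) (α := a) (β := b') (γ := c) (by ring) (by ring) (by ring)
      rfl h1 hkl h0
  · obtain ⟨p, q, n, h1, k, l, hkl⟩ := exists_norm_eq_neg_sq (d := b ^ 2 - 4 * a * c) (M := g * a)
      hD h (fun h => by
        have : (2 : ℤ) ∣ b ^ 2 := (dvd_add ((show (2 : ℤ) ∣ 4 by norm_num).trans h)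
          (Dvd.intro (2 * a * c) rfl)).trans (dvd_of_eq (by ring))
        have h2 : Even (b ^ 2) := even_iff_two_dvd.mpr this
        exact (Int.not_even_iff_odd.mpr hb.pow) h2) hga
    exact isometric_neg_plane (μ := g) (α := 2 * a) (β := b) (γ := 2 * c) (by ring) (by ring)
      (by ring) (by ring) h1 hkl h0

theorem toBilin'_planeGram (A B C : ℤ) (u v : Fin 4 → ℤ) :
    Matrix.toBilin' (planeGram A B C) u v =
      2 * A * (u 0 * v 0) + B * (u 0 * v 1 + u 1 * v 0) + 2 * C * (u 1 * v 1) + u 2 * v 3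
        + u 3 * v 2 := by
  simp [Matrix.toBilin'_apply, planeGram, Fin.sum_univ_succ]
  ring

/-- An elementary form of the comparison of discriminant forms: vectors whose pairings are all
multiples of `gD` are carried to such vectors, and their norms encode values of `f₀` modulo `D`. -/
theorem exists_dvd_add_of_isometric_neg_plane {g a b c : ℤ} (hg : g ≠ 0)
    (hD : b ^ 2 - 4 * a * c ≠ 0)
    (h : Isometric (Matrix.toBilin' (planeGram (-(g * a)) (-(g * b)) (-(g * c))))
      (Matrix.toBilin' (planeGram (g * a) (g * b) (g * c)))) (s t : ℤ) :
    ∃ x y : ℤ, b ^ 2 - 4 * a * c ∣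
      (a * s ^ 2 + b * s * t + c * t ^ 2) + (a * x ^ 2 + b * x * y + c * y ^ 2) := by
  obtain ⟨e, he⟩ := h
  set D := b ^ 2 - 4 * a * c with hDdef
  -- The adjugate of the Gram matrix applied to `(s, t)`, rotated so that `f₀(ξ) = -D f₀(s, t)` and
  -- all pairings of `ξ` are multiples of `gD`.
  set ξ : Fin 4 → ℤ := ![-2 * c * t - b * s, b * t + 2 * a * s, 0, 0] with hξ
  have hdvd : ∀ z, g * D ∣ Matrix.toBilin' (planeGram (g * a) (g * b) (g * c)) (e ξ) z := by
    intro z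
    obtain ⟨y, rfl⟩ := e.surjective z
    rw [he, toBilin'_planeGram]
    refine ⟨-t * y 0 + s * y 1, ?_⟩
    simp [hξ, hDdef]
    ring
  have hQ := he ξ ξ
  set η := e ξ
  obtain ⟨w1, h1⟩ := hdvd ![1, 0, 0, 0]
  obtain ⟨w2, h2⟩ := hdvd ![0, 1, 0, 0]
  obtain ⟨x, h3⟩ := hdvd ![0, 0, 0, 1]
  obtain ⟨y, h4⟩ := hdvd ![0, 0, 1, 0]
  simp only [toBilin'_planeGram] at h1 h2 h3 h4 hQ
  simp [hξ] at h1 h2 h3 h4 hQ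
  have hgD : g * D ≠ 0 := mul_ne_zero hg hD
  have k1 : 2 * a * η 0 + b * η 1 = D * w1 := by
    apply mul_left_cancel₀ hg; linear_combination h1
  have k2 : b * η 0 + 2 * c * η 1 = D * w2 := by
    apply mul_left_cancel₀ hg; linear_combination h2
  have e0 : η 0 = b * w2 - 2 * c * w1 := by
    apply mul_left_cancel₀ hD; rw [hDdef] at *; linear_combination b * k2 - 2 * c * k1
  have e1 : η 1 = b * w1 - 2 * a * w2 := by
    apply mul_left_cancel₀ hD; rw [hDdef] at *; linear_combination b * k1 - 2 * a * k2
  -- The binary part of `η` is the same adjugate vector built from `(-w2, w1)`, and its hyperbolic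
  -- part `gD(x, y)` contributes `2g²D²xy` to the norm.
  refine ⟨-w2, w1, g * x * y, ?_⟩
  apply mul_left_cancel₀ (mul_ne_zero two_ne_zero hgD)
  rw [e0, e1, h3, h4] at hQ
  rw [hDdef] at *
  linear_combination -hQ

theorem exists_prime_not_dvd {a b c : ℤ} (hprim : ∀ p : ℕ, p.Prime → (p : ℤ) ∣ a → (p : ℤ) ∣ b →
    (p : ℤ) ∣ c → False) {p : ℕ} (hp : p.Prime) :
    ∃ s t : ℤ, ¬ (p : ℤ) ∣ a * s ^ 2 + b * s * t + c * t ^ 2 := by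
  by_contra! h
  have h1 : (p : ℤ) ∣ a := by simpa using h 1 0
  have h2 : (p : ℤ) ∣ c := by simpa using h 0 1
  have h3 : (p : ℤ) ∣ a + b + c := by simpa using h 1 1
  refine hprim p hp h1 ?_ h2
  exact (dvd_sub (dvd_sub h3 h1) h2).trans (dvd_of_eq (by ring))

/-- Choose a value `f` of the form prime to `p`. As `-f` is also a value modulo `p` and `D` vanishes
there, the identity `4 f₀(s,t) f₀(x,y) = N² - D (sy - tx)²` gives `N² = -4f²`, so `-1` is a square
modulo `p`. -/
theorem not_prime_dvd_discr {a b c : ℤ}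
    (hprim : ∀ p : ℕ, p.Prime → (p : ℤ) ∣ a → (p : ℤ) ∣ b → (p : ℤ) ∣ c → False)
    (h : ∀ s t : ℤ, ∃ x y : ℤ, b ^ 2 - 4 * a * c ∣
      (a * s ^ 2 + b * s * t + c * t ^ 2) + (a * x ^ 2 + b * x * y + c * y ^ 2))
    {p : ℕ} (hp : p.Prime) (hp3 : p % 4 = 3) : ¬ (p : ℤ) ∣ b ^ 2 - 4 * a * c := by
  intro hpD
  have := Fact.mk hp
  obtain ⟨s, t, hst⟩ := exists_prime_not_dvd hprim hp
  obtain ⟨x, y, hxy⟩ := h s t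
  have hz := hpD.trans hxy
  rw [← ZMod.intCast_zmod_eq_zero_iff_dvd] at hpD hz hst
  push_cast at hpD hz hst
  set f := (a * s ^ 2 + b * s * t + c * t ^ 2 : ZMod p)
  have h2 : (2 : ZMod p) ≠ 0 := by
    intro h0
    have : p ∣ 2 := (ZMod.natCast_eq_zero_iff 2 p).mp (by exact_mod_cast h0)
    have := (Nat.prime_dvd_prime_iff_eq hp Nat.prime_two).mp this
    omega
  refine ZMod.exists_sq_eq_neg_one_iff.mp ?_ hp3
  refine ⟨(2 * a * s * x + b * (s * y + t * x) + 2 * c * t * y) / (2 * f), ?_⟩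
  have h2f : 2 * f ≠ 0 := mul_ne_zero h2 hst
  rw [div_mul_div_comm, eq_div_iff (mul_ne_zero h2f h2f)]
  linear_combination (-(s * y - t * x) ^ 2) * hpD - 4 * f * hz

theorem not_sixteen_dvd_discr {a b c : ℤ}
    (hprim : ∀ p : ℕ, p.Prime → (p : ℤ) ∣ a → (p : ℤ) ∣ b → (p : ℤ) ∣ c → False)
    (h : ∀ s t : ℤ, ∃ x y : ℤ, b ^ 2 - 4 * a * c ∣
      (a * s ^ 2 + b * s * t + c * t ^ 2) + (a * x ^ 2 + b * x * y + c * y ^ 2)) :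
    ¬ (16 : ℤ) ∣ b ^ 2 - 4 * a * c := by
  intro hD
  obtain ⟨s, t, hst⟩ := exists_prime_not_dvd hprim Nat.prime_two
  obtain ⟨x, y, hxy⟩ := h s t
  have hz := hD.trans hxy
  have hb : Even b := by
    have : Even (b ^ 2) := even_iff_two_dvd.mpr ((dvd_add ((show (2 : ℤ) ∣ 16 by norm_num).trans hD)
      (Dvd.intro (2 * a * c) rfl)).trans (dvd_of_eq (by ring)))
    simpa [Int.even_pow] using this
  obtain ⟨b, rfl⟩ := hb.two_dvd
  obtain ⟨e, he⟩ := hD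
  obtain ⟨k, hk⟩ := hz
  set f := a * s ^ 2 + 2 * b * s * t + c * t ^ 2 with hf
  have hfo : Odd f := by
    rw [← Int.not_even_iff_odd, even_iff_two_dvd]; exact_mod_cast hst
  obtain ⟨j, hj⟩ := hfo
  -- With `b` even, halving the polar form gives the product identity with `D/4`, a multiple of `4`.
  -- So a square is `-f²` modulo `4` with `f` odd, hence `-1` modulo `4`.
  have key : (a * s * x + b * (s * y + t * x) + c * t * y) ^ 2 =
      4 * (4 * f * k + e * (s * y - t * x) ^ 2 - j ^ 2 - j) - 1 := by
    have h1 : (a * s * x + b * (s * y + t * x) + c * t * y) ^ 2 =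
      f * (16 * k - f) + 4 * e * (s * y - t * x) ^ 2 := by
      rw [show 16 * k - f = (a * x ^ 2 + 2 * b * x * y + c * y ^ 2) by linarith]
      have he' : b ^ 2 - a * c = 4 * e := by linarith
      linear_combination (s * y - t * x) ^ 2 * he'
    rw [h1, hj]; ring
  rcases Int.even_or_odd (a * s * x + b * (s * y + t * x) + c * t * y) with ⟨r, hr⟩ | ⟨r, hr⟩ <;>
    rw [hr] at key <;> ring_nf at key <;> omega

theorem isometric_neg_plane_iff {g a b c : ℤ} (hga : g * a ≠ 0) (hD : 0 < b ^ 2 - 4 * a * c)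
    (hprim : ∀ p : ℕ, p.Prime → (p : ℤ) ∣ a → (p : ℤ) ∣ b → (p : ℤ) ∣ c → False) :
    Isometric (Matrix.toBilin' (planeGram (-(g * a)) (-(g * b)) (-(g * c))))
      (Matrix.toBilin' (planeGram (g * a) (g * b) (g * c))) ↔
      (∀ p : ℕ, p.Prime → p % 4 = 3 → ¬ (p : ℤ) ∣ b ^ 2 - 4 * a * c) ∧
        ¬ (16 : ℤ) ∣ b ^ 2 - 4 * a * c := by
  refine ⟨fun h => ?_, fun h => isometric_neg_plane_of_discr hga hD h.1 h.2⟩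
  have h' := exists_dvd_add_of_isometric_neg_plane (left_ne_zero_of_mul hga) hD.ne' h
  exact ⟨fun p hp hp3 => not_prime_dvd_discr hprim h' hp hp3, not_sixteen_dvd_discr hprim h'⟩

/-! ### Orbits of vectors and of rank-two sublattices in `U²` and `U³`. -/

/-- The quadratic form of the sum of two hyperbolic planes. -/
def quadU2 (x : (ℤ × ℤ) × (ℤ × ℤ)) : ℤ := x.1.1 * x.1.2 + x.2.1 * x.2.2

/-- The quadratic form of the sum of three hyperbolic planes. -/
def quadU3 (x : (ℤ × ℤ) × (ℤ × ℤ) × (ℤ × ℤ)) : ℤ :=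
  x.1.1 * x.1.2 + x.2.1.1 * x.2.1.2 + x.2.2.1 * x.2.2.2

/-- Two vectors lie in the same orbit of the automorphism group of a quadratic form. -/
def SameOrbit {M : Type*} [AddCommGroup M] (Q : M → ℤ) (x y : M) : Prop :=
  ∃ σ : M ≃ₗ[ℤ] M, (∀ z, Q (σ z) = Q z) ∧ σ x = y

theorem SameOrbit.trans {M : Type*} [AddCommGroup M] {Q : M → ℤ} {x y z : M}
    (h : SameOrbit Q x y) (h' : SameOrbit Q y z) : SameOrbit Q x z := by
  obtain ⟨σ, h1, h2⟩ := h
  obtain ⟨τ, h3, h4⟩ := h'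
  exact ⟨σ.trans τ, fun w => by simp [h1, h3], by simp [h2, h4]⟩

theorem SameOrbit.refl {M : Type*} [AddCommGroup M] (Q : M → ℤ) (x : M) : SameOrbit Q x x :=
  ⟨LinearEquiv.refl ℤ M, fun _ => rfl, rfl⟩

theorem sameOrbit_swap (u v : ℤ × ℤ) : SameOrbit quadU2 (u, v) (v, u) :=
  ⟨LinearEquiv.prodComm ℤ _ _, fun z => by simp [quadU2, add_comm], rfl⟩

theorem sameOrbit_flip (a b : ℤ) (v : ℤ × ℤ) : SameOrbit quadU2 ((a, b), v) ((b, a), v) :=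
  ⟨(LinearEquiv.prodComm ℤ ℤ ℤ).prodCongr (LinearEquiv.refl ℤ _),
    fun z => by simp [quadU2, mul_comm], rfl⟩

theorem sameOrbit_neg (a b : ℤ) (v : ℤ × ℤ) : SameOrbit quadU2 ((a, b), v) ((-a, -b), v) :=
  ⟨(LinearEquiv.neg ℤ).prodCongr (LinearEquiv.refl ℤ _),
    fun z => by simp [quadU2], rfl⟩

/-- Seen as the matrix with rows `(a, -c)` and `(d, b)`, a vector of `U²` has its determinant as
quadratic form; this is an elementary row operation, and `sameOrbit_reduce` is the column one. -/
theorem sameOrbit_transvection (k a b c d : ℤ) :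
    SameOrbit quadU2 ((a, b), (c, d)) ((a + k * d, b), (c - k * b, d)) := by
  refine ⟨
    { toFun := fun x => ((x.1.1 + k * x.2.2, x.1.2), (x.2.1 - k * x.1.2, x.2.2))
      invFun := fun x => ((x.1.1 - k * x.2.2, x.1.2), (x.2.1 + k * x.1.2, x.2.2))
      map_add' := fun x y => by ext <;> simp <;> ring
      map_smul' := fun n x => by ext <;> simp <;> ring
      left_inv := fun x => by ext <;> simp
      right_inv := fun x => by ext <;> simp }, fun z => ?_, rfl⟩
  simp [quadU2]
  ring

theorem sameOrbit_reduce (k a b c d : ℤ) :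
    SameOrbit quadU2 ((a, b), (c, d)) ((a, b + k * d), (c - k * a, d)) :=
  ((sameOrbit_flip a b _).trans (sameOrbit_transvection k b a c d)).trans (sameOrbit_flip _ _ _)

/-- Smith normal form of a `2 × 2` matrix, by Euclid's algorithm on `|a|`. -/
theorem exists_sameOrbit_of_ne_zero (n : ℕ) : ∀ a b c d : ℤ, a ≠ 0 → a.natAbs = n →
    ∃ e f : ℤ, SameOrbit quadU2 ((a, b), (c, d)) ((e, e * f), (0, 0)) := by
  induction n using Nat.strong_induction_on with
  | _ n ih =>
    intro a b c d ha hn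
    have key : ∀ b c d : ℤ, ¬ a ∣ c →
        ∃ e f : ℤ, SameOrbit quadU2 ((a, b), (c, d)) ((e, e * f), (0, 0)) := by
      intro b c d hac
      have h0 : c - c / a * a ≠ 0 := fun h => hac ⟨c / a, by linarith⟩
      have hlt : (c - c / a * a).natAbs < n := by
        have h1 : c - c / a * a = c % a := by have := Int.emod_add_mul_ediv c a; linarith
        have h2 := Int.emod_nonneg c ha
        have h3 := Int.emod_lt_abs c ha
        rw [h1, ← hn]
        zify
        rwa [abs_of_nonneg h2]
      obtain ⟨e, f, h⟩ := ih _ hlt (c - c / a * a) d a (b + c / a * d) h0 rfl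
      exact ⟨e, f, ((sameOrbit_reduce (c / a) a b c d).trans (sameOrbit_swap _ _)).trans h⟩
    have flip2 : ∀ b c d : ℤ, SameOrbit quadU2 ((a, b), (c, d)) ((a, b), (d, c)) := fun b c d =>
      ((sameOrbit_swap _ _).trans (sameOrbit_flip _ _ _)).trans (sameOrbit_swap _ _)
    by_cases hc : a ∣ c
    · obtain ⟨c, rfl⟩ := hc
      have h1 : SameOrbit quadU2 ((a, b), (a * c, d)) ((a, b + c * d), (d, 0)) := by
        have := (sameOrbit_reduce c a b (a * c) d).trans (flip2 _ _ _)
        rwa [show a * c - c * a = 0 by ring] at this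
      by_cases hd : a ∣ d
      · obtain ⟨d, rfl⟩ := hd
        have h2 : SameOrbit quadU2 ((a, b), (a * c, a * d)) ((a, b + c * (a * d)), (0, 0)) := by
          have := h1.trans (sameOrbit_reduce d _ _ _ _)
          rwa [show a * d - d * a = 0 by ring, mul_zero, add_zero] at this
        by_cases hb : a ∣ b + c * (a * d)
        · obtain ⟨f, hf⟩ := hb
          exact ⟨a, f, hf ▸ h2⟩
        -- The second plane is already clear but `a` does not divide the other diagonal entry: a
        -- transvection copies that entry into the second plane, where division by `a` leaves a
        -- smaller nonzero remainder.
        · have h3 := h2.trans (sameOrbit_transvection 1 _ _ _ _)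
          rw [mul_zero, add_zero] at h3
          obtain ⟨e, f, h4⟩ := key (b + c * (a * d)) (0 - 1 * (b + c * (a * d))) 0
            (by rwa [one_mul, zero_sub, dvd_neg])
          exact ⟨e, f, h3.trans h4⟩
      · obtain ⟨e, f, h2⟩ := key _ _ _ hd
        exact ⟨e, f, h1.trans h2⟩
    · exact key b c d hc

theorem exists_sameOrbit (x : (ℤ × ℤ) × (ℤ × ℤ)) :
    ∃ e f : ℤ, SameOrbit quadU2 x ((e, e * f), (0, 0)) := by
  obtain ⟨⟨a, b⟩, ⟨c, d⟩⟩ := x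
  by_cases ha : a = 0
  · by_cases hb : b = 0
    · by_cases hc : c = 0
      · by_cases hd : d = 0
        · subst ha hb hc hd
          exact ⟨0, 0, SameOrbit.refl _ _⟩
        · obtain ⟨e, f, h⟩ := exists_sameOrbit_of_ne_zero _ d c a b hd rfl
          exact ⟨e, f, ((sameOrbit_swap _ _).trans (sameOrbit_flip _ _ _)).trans h⟩
      · obtain ⟨e, f, h⟩ := exists_sameOrbit_of_ne_zero _ c d a b hc rfl
        exact ⟨e, f, (sameOrbit_swap _ _).trans h⟩
    · obtain ⟨e, f, h⟩ := exists_sameOrbit_of_ne_zero _ b a c d hb rfl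
      exact ⟨e, f, (sameOrbit_flip _ _ _).trans h⟩
  · exact exists_sameOrbit_of_ne_zero _ a b c d ha rfl

/-- An automorphism of `U²` extends to `U³ = U ⊕ U²`. -/
theorem exists_extend_right (σ : ((ℤ × ℤ) × (ℤ × ℤ)) ≃ₗ[ℤ] ((ℤ × ℤ) × (ℤ × ℤ)))
    (hσ : ∀ z, quadU2 (σ z) = quadU2 z) :
    ∃ τ : ((ℤ × ℤ) × (ℤ × ℤ) × (ℤ × ℤ)) ≃ₗ[ℤ] ((ℤ × ℤ) × (ℤ × ℤ) × (ℤ × ℤ)),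
      (∀ z, quadU3 (τ z) = quadU3 z) ∧ ∀ u v, τ (u, v) = (u, σ v) := by
  refine ⟨(LinearEquiv.refl ℤ _).prodCongr σ, fun z => ?_, fun u v => rfl⟩
  have := hσ z.2
  simp only [quadU2, quadU3, LinearEquiv.prodCongr_apply, LinearEquiv.refl_apply] at *
  linarith

theorem sameOrbit_swap_left (u v w : ℤ × ℤ) : SameOrbit quadU3 (u, v, w) (v, u, w) := by
  refine ⟨((LinearEquiv.prodAssoc ℤ _ _ _).symm.trans
    ((LinearEquiv.prodComm ℤ _ _).prodCongr (LinearEquiv.refl ℤ _))).trans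
      (LinearEquiv.prodAssoc ℤ _ _ _), fun z => ?_, rfl⟩
  obtain ⟨u, v, w⟩ := z
  change v.1 * v.2 + u.1 * u.2 + w.1 * w.2 = u.1 * u.2 + v.1 * v.2 + w.1 * w.2
  ring

theorem sameOrbit_right {u : ℤ × ℤ} {v w : (ℤ × ℤ) × (ℤ × ℤ)} (h : SameOrbit quadU2 v w) :
    SameOrbit quadU3 (u, v) (u, w) := by
  obtain ⟨σ, h1, h2⟩ := h
  obtain ⟨τ, h3, h4⟩ := exists_extend_right σ h1
  exact ⟨τ, h3, by rw [h4, h2]⟩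

theorem SameOrbit.dvd_of {M : Type*} [AddCommGroup M] {Q : M → ℤ} {x y z : M} {n : ℤ}
    (h : SameOrbit Q x y) (hy : y = n • z) : ∃ w, x = n • w := by
  obtain ⟨σ, -, hσ⟩ := h
  exact ⟨σ.symm z, by rw [← map_zsmul, ← hy, ← hσ, σ.symm_apply_apply]⟩

/-- A primitive vector of `U³` can be moved into the standard position in the first summand. -/
theorem exists_sameOrbit_of_primitive (x : (ℤ × ℤ) × (ℤ × ℤ) × (ℤ × ℤ))
    (hx : ∀ (n : ℤ) z, x = n • z → IsUnit n) :
    ∃ a : ℤ, SameOrbit quadU3 x ((1, a), (0, 0), (0, 0)) := by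
  obtain ⟨u, v⟩ := x
  obtain ⟨e, f, h⟩ := exists_sameOrbit v
  have h1 : SameOrbit quadU3 (u, v) ((0, 0), u, (e, e * f)) :=
    (sameOrbit_right (h.trans (sameOrbit_swap _ _))).trans (sameOrbit_swap_left _ _ _)
  obtain ⟨e', f', h'⟩ := exists_sameOrbit (u, (e, e * f))
  have h2 := (h1.trans (sameOrbit_right h')).trans (sameOrbit_swap_left _ _ _)
  obtain ⟨w, hw⟩ := h2.dvd_of (n := e') (z := ((1, f'), (0, 0), (0, 0))) (by simp)
  rcases Int.isUnit_iff.mp (hx e' w hw) with rfl | rfl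
  · exact ⟨f', by simpa using h2⟩
  · refine ⟨f', ?_⟩
    have h3 := ((h1.trans (sameOrbit_right h')).trans
      (sameOrbit_right (sameOrbit_neg _ _ _))).trans (sameOrbit_swap_left _ _ _)
    simpa using h3

theorem exists_sameOrbit_of_primitive_quadU2 (x : (ℤ × ℤ) × (ℤ × ℤ))
    (hx : ∀ (n : ℤ) z, x = n • z → IsUnit n) :
    ∃ a : ℤ, SameOrbit quadU2 x ((1, a), (0, 0)) := by
  obtain ⟨e, f, h⟩ := exists_sameOrbit x
  obtain ⟨w, hw⟩ := h.dvd_of (n := e) (z := ((1, f), (0, 0))) (by simp)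
  rcases Int.isUnit_iff.mp (hx e w hw) with rfl | rfl
  · exact ⟨f, by simpa using h⟩
  · exact ⟨f, by simpa using h.trans (sameOrbit_neg _ _ _)⟩

/-- An Eichler transvection of `U³` that fixes `((1, a), 0, 0)`. -/
theorem exists_eichler_transvection (a : ℤ) :
    ∃ τ : ((ℤ × ℤ) × (ℤ × ℤ) × (ℤ × ℤ)) ≃ₗ[ℤ] ((ℤ × ℤ) × (ℤ × ℤ) × (ℤ × ℤ)),
      (∀ z, quadU3 (τ z) = quadU3 z) ∧ τ ((1, a), (0, 0), (0, 0)) = ((1, a), (0, 0), (0, 0)) ∧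
      ∀ b u, τ ((0, b), u, (0, 0)) = ((0, b), u, (0, -b)) := by
  refine ⟨
    { toFun := fun x => ((x.1.1 + x.2.2.1, x.1.2 - a * x.2.2.1), x.2.1,
        (x.2.2.1, x.2.2.2 - x.1.2 + a * x.1.1 + a * x.2.2.1))
      invFun := fun x => ((x.1.1 - x.2.2.1, x.1.2 + a * x.2.2.1), x.2.1,
        (x.2.2.1, x.2.2.2 + x.1.2 - a * x.1.1 + a * x.2.2.1))
      map_add' := fun x y => by ext <;> simp <;> ring
      map_smul' := fun n x => by ext <;> simp <;> ring
      left_inv := fun x => by ext <;> simp; ring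
      right_inv := fun x => by ext <;> simp; ring }, fun z => ?_, ?_, fun b u => ?_⟩
  · simp [quadU3]
    ring
  · simp
  · simp

/-- A primitive sublattice of rank two of `U³` can be moved into the standard position. -/
theorem exists_normal_form (x y : (ℤ × ℤ) × (ℤ × ℤ) × (ℤ × ℤ))
    (hxy : ∀ (n s t : ℤ) z, s • x + t • y = n • z → n ∣ s ∧ n ∣ t) :
    ∃ (σ : ((ℤ × ℤ) × (ℤ × ℤ) × (ℤ × ℤ)) ≃ₗ[ℤ] ((ℤ × ℤ) × (ℤ × ℤ) × (ℤ × ℤ))) (a b c k : ℤ),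
      (∀ z, quadU3 (σ z) = quadU3 z) ∧ σ x = ((1, a), (0, 0), (0, 0)) ∧
      σ (y - k • x) = ((0, b), (1, c), (0, 0)) := by
  obtain ⟨a, σ, hσ, hσx⟩ := exists_sameOrbit_of_primitive x fun n z hz =>
    isUnit_of_dvd_one (hxy n 1 0 z (by simpa using hz)).1
  obtain ⟨⟨⟨k, y1⟩, y'⟩, hy⟩ : ∃ w, σ y = w := ⟨_, rfl⟩
  have hy' : σ (y - k • x) = ((0, y1 - k * a), y') := by
    rw [map_sub, map_zsmul, hσx, hy]
    simp
  obtain ⟨e, f, τ, hτ, hτy⟩ := exists_sameOrbit y'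
  obtain ⟨τ', hτ', hτ''⟩ := exists_extend_right τ hτ
  -- The entry `b = y1 - k a` in the first plane may be what makes `y - k x` primitive. The
  -- transvection fixes the image of `x` and copies `-b` into the last plane, so that the
  -- `U²`-component becomes primitive and can be moved to `((1, c), 0)` without touching the first
  -- plane.
  obtain ⟨ρ, hρ, hρx, hρy⟩ := exists_eichler_transvection a
  have h3 : ρ (τ' (σ (y - k • x))) = ((0, y1 - k * a), (e, e * f), (0, -(y1 - k * a))) := by
    rw [hy', hτ'', hτy, hρy]
  obtain ⟨c, π, hπ, hπy⟩ := exists_sameOrbit_of_primitive_quadU2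
      ((e, e * f), (0, -(y1 - k * a))) (by
    rintro n ⟨⟨z1, z2⟩, ⟨z3, z4⟩⟩ hz
    simp only [Prod.smul_mk, smul_eq_mul, Prod.mk.injEq] at hz
    have h4 : σ (y - k • x) = n • (τ'.symm (ρ.symm ((0, -z4), (z1, z2), (0, z4)))) := by
      rw [← map_zsmul, ← map_zsmul, LinearEquiv.eq_symm_apply, LinearEquiv.eq_symm_apply, h3]
      simp only [Prod.smul_mk, smul_eq_mul, Prod.mk.injEq, mul_zero, true_and]
      refine ⟨?_, ⟨hz.1.1, hz.1.2⟩, hz.2.2⟩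
      linear_combination - hz.2.2
    have h5 := (hxy n (-k) 1 (σ.symm (τ'.symm (ρ.symm ((0, -z4), (z1, z2), (0, z4))))) (by
      rw [← map_zsmul, LinearEquiv.eq_symm_apply, ← h4]
      congr 1
      module)).2
    exact isUnit_of_dvd_one h5)
  obtain ⟨π', hπ', hπ''⟩ := exists_extend_right π hπ
  refine ⟨((σ.trans τ').trans ρ).trans π', a, y1 - k * a, c, k, fun z => ?_, ?_, ?_⟩
  · simp only [LinearEquiv.trans_apply, hπ', hρ, hτ', hσ]
  · have hz : ∀ κ : ((ℤ × ℤ) × (ℤ × ℤ)) ≃ₗ[ℤ] ((ℤ × ℤ) × (ℤ × ℤ)),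
        κ ((0, 0), (0, 0)) = ((0, 0), (0, 0)) := fun κ => κ.map_zero
    rw [LinearEquiv.trans_apply, LinearEquiv.trans_apply, LinearEquiv.trans_apply, hσx, hτ'', hz,
      hρx, hπ'', hz]
  · simp only [LinearEquiv.trans_apply, h3, hπ'', hπy]

/-! ### The orthogonal complement of a saturated sublattice of rank two in `U³`. -/

theorem exists_basis_change {M : Type*} [AddCommGroup M] (b : Basis (Fin 2) ℤ M) (p q r s : ℤ)
    (h : IsUnit (p * s - q * r)) :
    ∃ b' : Basis (Fin 2) ℤ M, b' 0 = p • b 0 + q • b 1 ∧ b' 1 = r • b 0 + s • b 1 := by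
  have hv : IsUnit (b.det ![p • b 0 + q • b 1, r • b 0 + s • b 1]) := by
    rw [Basis.det_apply, Matrix.det_fin_two]
    simpa [Basis.toMatrix_apply, Finsupp.single_apply, mul_comm q r] using h
  rw [← Basis.is_basis_iff_det] at hv
  exact ⟨Basis.mk hv.1 hv.2.ge, by simp, by simp⟩

/-- The Gram matrix of an even form on a lattice of rank two. -/
def HasGram {M : Type*} [AddCommGroup M] (β : LinearMap.BilinForm ℤ M) (b : Basis (Fin 2) ℤ M)
    (A B C : ℤ) : Prop :=
  β (b 0) (b 0) = 2 * A ∧ β (b 0) (b 1) = B ∧ β (b 1) (b 0) = B ∧ β (b 1) (b 1) = 2 * C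

/-- The orthogonal complement of a primitive sublattice of rank two of `U³`. -/
theorem exists_isometric_orthogonal {H : Type*} [AddCommGroup H] (β : LinearMap.BilinForm ℤ H)
    (hs : β.IsSymm) (φ : H ≃ₗ[ℤ] ((ℤ × ℤ) × (ℤ × ℤ) × (ℤ × ℤ)))
    (hφ : ∀ x, β x x = 2 * quadU3 (φ x)) (K : Submodule ℤ H)
    (hK : ∀ (n : ℤ) (x : H), n ≠ 0 → n • x ∈ K → x ∈ K) (b : Basis (Fin 2) ℤ K) :
    ∃ (b' : Basis (Fin 2) ℤ K) (A B C : ℤ), b' 0 = b 0 ∧ HasGram (β.restrict K) b' A B C ∧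
      Isometric (β.restrict (β.orthogonal K))
        (Matrix.toBilin' (planeGram (-A) (-B) (-C))) := by
  have hxy : ∀ (n s t : ℤ) z, s • φ (b 0) + t • φ (b 1) = n • z → n ∣ s ∧ n ∣ t := by
    intro n s t z hz
    have h1 : s • (b 0 : H) + t • (b 1 : H) = n • φ.symm z := by
      apply φ.injective
      simpa using hz
    have h2 : n = 0 ∨ φ.symm z ∈ K := by
      rcases eq_or_ne n 0 with h | h
      · exact Or.inl h
      · exact Or.inr (hK n _ h (h1 ▸ K.add_mem (K.smul_mem _ (b 0).2) (K.smul_mem _ (b 1).2)))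
    obtain ⟨k, hk⟩ : ∃ k : K, s • b 0 + t • b 1 = n • k := by
      rcases h2 with rfl | h2
      · exact ⟨0, Subtype.ext (by simpa using h1)⟩
      · exact ⟨⟨_, h2⟩, Subtype.ext (by simpa using h1)⟩
    have h3 := congrArg (fun v => b.repr v 0) hk
    have h4 := congrArg (fun v => b.repr v 1) hk
    simp at h3 h4
    exact ⟨⟨_, h3⟩, ⟨_, h4⟩⟩
  obtain ⟨σ, a, c1, c, k, hσ, hσ0, hσ1⟩ := exists_normal_form _ _ hxy
  -- Only the second basis vector is modified; a first vector chosen non-isotropic stays available.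
  obtain ⟨b', hb0, hb1⟩ := exists_basis_change b 1 0 (-k) 1 (by simp)
  set ψ := φ.trans σ with hψ
  have hψ0 : ψ (b' 0) = ((1, a), (0, 0), (0, 0)) := by simp [hψ, hb0, hσ0]
  have hψ1 : ψ (b' 1) = ((0, c1), (1, c), (0, 0)) := by
    rw [← hσ1, hb1]
    simp [hψ]
    abel
  have hβ : ∀ x y, β x y = (ψ x).1.1 * (ψ y).1.2 + (ψ x).1.2 * (ψ y).1.1 +
      (ψ x).2.1.1 * (ψ y).2.1.2 + (ψ x).2.1.2 * (ψ y).2.1.1 +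
      (ψ x).2.2.1 * (ψ y).2.2.2 + (ψ x).2.2.2 * (ψ y).2.2.1 := by
    intro x y
    have h : ∀ z, β z z = 2 * quadU3 (ψ z) := fun z => by rw [hφ, hψ, LinearEquiv.trans_apply, hσ]
    have h1 := h (x + y)
    have h2 := h x
    have h3 := h y
    have h4 := hs.eq x y
    simp only [map_add, LinearMap.add_apply, quadU3, Prod.fst_add, Prod.snd_add]
      at h1 h2 h3 h4
    linarith
  refine ⟨b', a, c1, c, by simp [hb0], ⟨?_, ?_, ?_, ?_⟩, ?_⟩
  · change β (b' 0) (b' 0) = _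
    rw [hβ, hψ0]; ring
  · change β (b' 0) (b' 1) = _
    rw [hβ, hψ0, hψ1]; ring
  · change β (b' 1) (b' 0) = _
    rw [hβ, hψ0, hψ1]; ring
  · change β (b' 1) (b' 1) = _
    rw [hβ, hψ1]; ring
  -- Orthogonality determines the second coordinates in the first two planes from the first ones.
  -- The free coordinates are two integers carrying `-f` and a point of the third plane.
  have hmem : ∀ t : H, t ∈ β.orthogonal K ↔
      (ψ t).1.2 = -a * (ψ t).1.1 ∧ (ψ t).2.1.2 = -c1 * (ψ t).1.1 - c * (ψ t).2.1.1 := by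
    intro t
    have h0 := hβ (b' 0) t
    have h1 := hβ (b' 1) t
    rw [hψ0] at h0
    rw [hψ1] at h1
    simp only [one_mul, zero_mul, zero_add, add_zero] at h0 h1
    rw [LinearMap.BilinForm.mem_orthogonal_iff]
    constructor
    · intro h
      have h2 : β (b' 0) t = 0 := h _ (b' 0).2
      have h3 : β (b' 1) t = 0 := h _ (b' 1).2
      exact ⟨by linarith, by linarith⟩
    · rintro ⟨h2, h3⟩ n hn
      have h4 : n = (b'.repr ⟨n, hn⟩ 0) • (b' 0 : H) + (b'.repr ⟨n, hn⟩ 1) • (b' 1 : H) := by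
        have := b'.sum_repr ⟨n, hn⟩
        rw [Fin.sum_univ_two] at this
        exact congrArg Subtype.val this.symm
      change β n t = 0
      rw [h4]
      simp only [map_add, map_zsmul, LinearMap.add_apply, LinearMap.smul_apply, h0, h1, h2, h3,
        smul_eq_mul]
      ring
  refine ⟨
    { toFun := fun t => ![(ψ t).1.1, (ψ t).2.1.1, (ψ t).2.2.1, (ψ t).2.2.2]
      invFun := fun v => ⟨ψ.symm ((v 0, -a * v 0), (v 1, -c1 * v 0 - c * v 1), (v 2, v 3)), by
        rw [hmem]; simp⟩
      map_add' := fun x y => by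
        simp only [Submodule.coe_add, map_add, Prod.fst_add, Prod.snd_add]
        simp
      map_smul' := fun n x => by
        simp only [Submodule.coe_smul, map_smul, Prod.smul_fst, Prod.smul_snd]
        simp
      left_inv := fun t => by
        apply Subtype.ext
        apply ψ.injective
        have := (hmem t).mp t.2
        simp only [LinearEquiv.apply_symm_apply]
        ext <;> simp [this.1, this.2]
      right_inv := fun v => by ext i; fin_cases i <;> simp }, fun x y => ?_⟩
  have h1 := (hmem x).mp x.2
  have h2 := (hmem y).mp y.2
  have h3 := hβ x y
  rw [h1.1, h1.2, h2.1, h2.2] at h3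
  refine Eq.trans ?_ h3.symm
  rw [toBilin'_planeGram]
  simp
  ring

/-! ### `H²`, `NS`, `N` and `T` in coordinates. -/

section
variable {V : Type*} [NormedAddCommGroup V]

/-- The alternating form `xᵢ ∧ xⱼ` for the coordinates `x` of a basis. -/
noncomputable def coordWedge {Λ : Submodule ℤ V} (b : Basis (Fin 4) ℤ Λ) (i j : Fin 4) : H2 Λ :=
  (Matrix.detRowAlternating (n := Fin 2) (R := ℤ)).compLinearMap
    (LinearMap.pi ![b.coord i, b.coord j])

theorem coordWedge_apply {Λ : Submodule ℤ V} (b : Basis (Fin 4) ℤ Λ) (i j k l : Fin 4) :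
    coordWedge b i j ![b k, b l] =
      (if k = i then 1 else 0) * (if l = j then 1 else 0) -
        (if k = j then 1 else 0) * (if l = i then 1 else 0) := by
  change Matrix.det (Matrix.of fun m : Fin 2 =>
    LinearMap.pi ![b.coord i, b.coord j] (![b k, b l] m)) = _
  rw [Matrix.det_fin_two]
  simp [Finsupp.single_apply]

theorem H2.swap {Λ : Submodule ℤ V} (E : H2 Λ) (x y : Λ) : E ![y, x] = -E ![x, y] := by
  have := E.map_swap ![x, y] (show (0 : Fin 2) ≠ 1 by decide)
  rw [← this]
  congr 1
  ext i; fin_cases i <;> rfl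

theorem H2.ext_basis {Λ : Submodule ℤ V} (b : Basis (Fin 4) ℤ Λ) {E F : H2 Λ}
    (h : ∀ i j, i < j → E ![b i, b j] = F ![b i, b j]) : E = F := by
  refine b.ext_alternating fun v hv => ?_
  have hw : (fun i => b (v i)) = ![b (v 0), b (v 1)] := by
    ext i; fin_cases i <;> rfl
  rw [hw]
  rcases lt_or_gt_of_ne (hv.ne (show (0 : Fin 2) ≠ 1 by decide)) with h1 | h1
  · exact h _ _ h1
  · rw [H2.swap E, H2.swap F, h _ _ h1]

/-- `H²(X, ℤ)` in coordinates. -/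
noncomputable def h2Equiv {Λ : Submodule ℤ V} (b : Basis (Fin 4) ℤ Λ) :
    H2 Λ ≃ₗ[ℤ] ((ℤ × ℤ) × (ℤ × ℤ) × (ℤ × ℤ)) where
  -- The sign of the `b 1, b 3` entry turns the Pfaffian into `quadU3`.
  toFun E := ((E ![b 0, b 1], E ![b 2, b 3]), (E ![b 0, b 2], -E ![b 1, b 3]),
    (E ![b 0, b 3], E ![b 1, b 2]))
  invFun x := x.1.1 • coordWedge b 0 1 + x.1.2 • coordWedge b 2 3 + x.2.1.1 • coordWedge b 0 2
    - x.2.1.2 • coordWedge b 1 3 + x.2.2.1 • coordWedge b 0 3 + x.2.2.2 • coordWedge b 1 2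
  map_add' E F := by
    simp only [AlternatingMap.add_apply, Prod.mk_add_mk, neg_add]
  map_smul' n E := by
    simp only [AlternatingMap.smul_apply, Prod.smul_mk, smul_eq_mul, RingHom.id_apply, mul_neg]
  left_inv E := by
    refine H2.ext_basis b fun i j hij => ?_
    simp only [AlternatingMap.add_apply, AlternatingMap.sub_apply, AlternatingMap.smul_apply,
      coordWedge_apply, smul_eq_mul]
    fin_cases i <;> fin_cases j <;> simp at hij ⊢
  right_inv x := by
    simp only [AlternatingMap.add_apply, AlternatingMap.sub_apply, AlternatingMap.smul_apply,
      coordWedge_apply, smul_eq_mul]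
    simp

variable [NormedSpace ℂ V]

/-- Saturation of `NS(X)`: a Hermitian form may be divided by a nonzero integer, and the integrality
is already carried by `E`. -/
theorem NS.mem_of_zsmul_mem {Λ : Submodule ℤ V} (n : ℤ) (E : H2 Λ) (hn : n ≠ 0)
    (h : n • E ∈ NS Λ) : E ∈ NS Λ := by
  obtain ⟨H, hH, hE⟩ := h
  have hn' : (n : ℂ) ≠ 0 := Int.cast_ne_zero.mpr hn
  have him : ∀ z : ℂ, ((n : ℂ)⁻¹ * z).im = (n : ℝ)⁻¹ * z.im := fun z => by
    rw [← Complex.ofReal_intCast, ← Complex.ofReal_inv, Complex.im_ofReal_mul]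
  refine ⟨(n : ℂ)⁻¹ • H, fun x y => by simp [hH x y], fun x y => ?_⟩
  simp only [LinearMap.smul_apply, smul_eq_mul, him, hE, AlternatingMap.smul_apply]
  push_cast
  rw [inv_mul_cancel_left₀ (Int.cast_ne_zero.mpr hn)]

variable [Fact (finrank ℂ V = 2)] (Λ : Submodule ℤ V) [DiscreteTopology Λ] [IsZLattice ℝ Λ]

theorem intersectionForm_self (E : H2 Λ) :
    intersectionForm Λ E E = 2 * quadU3 (h2Equiv (exists_isOriented Λ).choose E) := by
  simp only [intersectionForm, LinearMap.mk₂_apply, degree, cup_apply, h2Equiv, quadU3]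
  simp
  ring

theorem HasGram.apply {M : Type*} [AddCommGroup M] {β : LinearMap.BilinForm ℤ M}
    {b : Basis (Fin 2) ℤ M} {A B C : ℤ} (h : HasGram β b A B C) (x y : M) :
    β x y = 2 * A * (b.repr x 0 * b.repr y 0) + B * (b.repr x 0 * b.repr y 1 +
      b.repr x 1 * b.repr y 0) + 2 * C * (b.repr x 1 * b.repr y 1) := by
  obtain ⟨h1, h2, h3, h4⟩ := h
  conv_lhs => rw [← b.sum_repr x, ← b.sum_repr y]
  simp only [Fin.sum_univ_two, map_add, map_zsmul, LinearMap.add_apply, LinearMap.smul_apply,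
    h1, h2, h3, h4, smul_eq_mul]
  ring

theorem isometric_numForm {A B C : ℤ} (b : Basis (Fin 2) ℤ (NS Λ))
    (h : HasGram (nsForm Λ) b A B C) :
    Isometric (numForm Λ) (Matrix.toBilin' (planeGram A B C)) := by
  refine ⟨
    -- The sign on the `H⁴` coordinate turns `-rs' - sr'` into the hyperbolic plane.
    { toFun := fun t => ![b.repr ⟨t.1.2.1, t.2.2.1⟩ 0, b.repr ⟨t.1.2.1, t.2.2.1⟩ 1, t.1.1, -t.1.2.2]
      invFun := fun v => ⟨(v 2, (v 0 • b 0 + v 1 • b 1 : NS Λ), -v 3),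
        ⟨trivial, (v 0 • b 0 + v 1 • b 1 : NS Λ).2, trivial⟩⟩
      map_add' := fun x y => by
        ext i; fin_cases i
        · exact congrArg (fun z => z 0) (b.repr.map_add ⟨x.1.2.1, x.2.2.1⟩ ⟨y.1.2.1, y.2.2.1⟩)
        · exact congrArg (fun z => z 1) (b.repr.map_add ⟨x.1.2.1, x.2.2.1⟩ ⟨y.1.2.1, y.2.2.1⟩)
        · rfl
        · exact neg_add _ _
      map_smul' := fun n x => by
        ext i; fin_cases i
        · exact congrArg (fun z => z 0) (b.repr.map_smul n ⟨x.1.2.1, x.2.2.1⟩)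
        · exact congrArg (fun z => z 1) (b.repr.map_smul n ⟨x.1.2.1, x.2.2.1⟩)
        · rfl
        · exact (mul_neg _ _).symm
      left_inv := fun t => by
        have := b.sum_repr ⟨t.1.2.1, t.2.2.1⟩
        rw [Fin.sum_univ_two] at this
        refine Subtype.ext (Prod.ext rfl (Prod.ext ?_ (neg_neg _)))
        exact congrArg Subtype.val this
      right_inv := fun v => by
        have h0 : b.repr (v 0 • b 0 + v 1 • b 1) 0 = v 0 := by simp
        have h1 : b.repr (v 0 • b 0 + v 1 • b 1) 1 = v 1 := by simp
        ext i; fin_cases i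
        · exact h0
        · exact h1
        · rfl
        · exact neg_neg _ }, fun x y => ?_⟩
  have h1 : numForm Λ x y = nsForm Λ ⟨x.1.2.1, x.2.2.1⟩ ⟨y.1.2.1, y.2.2.1⟩ - x.1.1 * y.1.2.2 -
    x.1.2.2 * y.1.1 := rfl
  have h2 := h.apply ⟨x.1.2.1, x.2.2.1⟩ ⟨y.1.2.1, y.2.2.1⟩
  rw [h2] at h1
  refine (toBilin'_planeGram A B C _ _).trans (Eq.trans ?_ h1.symm)
  simp only [LinearEquiv.coe_mk, LinearMap.coe_mk, AddHom.coe_mk, Matrix.cons_val]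
  ring

theorem exists_isometric_transForm (b : Basis (Fin 2) ℤ (NS Λ)) :
    ∃ (b' : Basis (Fin 2) ℤ (NS Λ)) (A B C : ℤ), b' 0 = b 0 ∧ HasGram (nsForm Λ) b' A B C ∧
      Isometric (transForm Λ) (Matrix.toBilin' (planeGram (-A) (-B) (-C))) :=
  exists_isometric_orthogonal (intersectionForm Λ) (intersectionForm_isSymm Λ)
    (h2Equiv (exists_isOriented Λ).choose) (intersectionForm_self Λ) (NS Λ)
    (fun n E hn h => NS.mem_of_zsmul_mem n E hn h) b

end

/-! ### Hermitian forms and the Hodge index theorem. -/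

section
variable {V : Type*} [NormedAddCommGroup V] [NormedSpace ℂ V]

/-- The determinant of a Hermitian form in a basis. -/
noncomputable def hermDet (c : Basis (Fin 2) ℂ V) (H : V →ₗ[ℂ] V →ₗ⋆[ℂ] ℂ) : ℝ :=
  (H (c 0) (c 0)).re * (H (c 1) (c 1)).re - (H (c 0) (c 1)).re ^ 2 - (H (c 0) (c 1)).im ^ 2

theorem IsHermitian.im_self {H : V →ₗ[ℂ] V →ₗ⋆[ℂ] ℂ} (hH : IsHermitian H) (x : V) :
    (H x x).im = 0 := by
  have := congrArg Complex.im (hH x x)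
  rw [Complex.conj_im] at this
  linarith

theorem IsHermitian.apply_eq {H : V →ₗ[ℂ] V →ₗ⋆[ℂ] ℂ} (hH : IsHermitian H)
    (c : Basis (Fin 2) ℂ V) (x y : V) :
    H x y = c.repr x 0 * conj (c.repr y 0) * H (c 0) (c 0) +
      c.repr x 0 * conj (c.repr y 1) * H (c 0) (c 1) +
      c.repr x 1 * conj (c.repr y 0) * conj (H (c 0) (c 1)) +
      c.repr x 1 * conj (c.repr y 1) * H (c 1) (c 1) := by
  conv_lhs => rw [← c.sum_repr x, ← c.sum_repr y]
  simp only [Fin.sum_univ_two, map_add, map_smulₛₗ, LinearMap.add_apply, LinearMap.smul_apply,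
    smul_eq_mul, hH (c 0) (c 1), RingHom.id_apply]
  ring

theorem IsHermitian.im_apply {H : V →ₗ[ℂ] V →ₗ⋆[ℂ] ℂ} (hH : IsHermitian H)
    (c : Basis (Fin 2) ℂ V) (x y : V) :
    (H x y).im =
      ((c.repr x 0).im * (c.repr y 0).re - (c.repr x 0).re * (c.repr y 0).im) * (H (c 0) (c 0)).re +
      ((c.repr x 1).im * (c.repr y 1).re - (c.repr x 1).re * (c.repr y 1).im) * (H (c 1) (c 1)).re +
      ((c.repr x 0).im * (c.repr y 1).re - (c.repr x 0).re * (c.repr y 1).im +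
        (c.repr x 1).im * (c.repr y 0).re - (c.repr x 1).re * (c.repr y 0).im) *
          (H (c 0) (c 1)).re +
      ((c.repr x 0).re * (c.repr y 1).re + (c.repr x 0).im * (c.repr y 1).im -
        (c.repr x 1).re * (c.repr y 0).re - (c.repr x 1).im * (c.repr y 0).im) *
          (H (c 0) (c 1)).im := by
  rw [hH.apply_eq c]
  simp [hH.im_self]
  ring

theorem det_four {R : Type*} [CommRing R] (M : Matrix (Fin 4) (Fin 4) R) :
    M.det = (M 0 0 * M 1 1 - M 1 0 * M 0 1) * (M 2 2 * M 3 3 - M 3 2 * M 2 3) -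
      (M 0 0 * M 2 1 - M 2 0 * M 0 1) * (M 1 2 * M 3 3 - M 3 2 * M 1 3) +
      (M 0 0 * M 3 1 - M 3 0 * M 0 1) * (M 1 2 * M 2 3 - M 2 2 * M 1 3) +
      (M 1 0 * M 2 1 - M 2 0 * M 1 1) * (M 0 2 * M 3 3 - M 3 2 * M 0 3) -
      (M 1 0 * M 3 1 - M 3 0 * M 1 1) * (M 0 2 * M 2 3 - M 2 2 * M 0 3) +
      (M 2 0 * M 3 1 - M 3 0 * M 2 1) * (M 0 2 * M 1 3 - M 1 2 * M 0 3) := by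
  rw [Matrix.det_succ_row_zero, Fin.sum_univ_four]
  simp only [Matrix.det_fin_three, Matrix.submatrix_apply]
  have h1 : (0:Fin 3).succ = (1 : Fin 4) := rfl
  have h2 : (1:Fin 3).succ = (2 : Fin 4) := rfl
  have h3 : (2:Fin 3).succ = (3 : Fin 4) := rfl
  have a0 : ∀ k : Fin 3, (0:Fin 4).succAbove k = ![1,2,3] k := by decide
  have a1 : ∀ k : Fin 3, (1:Fin 4).succAbove k = ![0,2,3] k := by decide
  have a2 : ∀ k : Fin 3, (2:Fin 4).succAbove k = ![0,1,3] k := by decide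
  have a3 : ∀ k : Fin 3, (3:Fin 4).succAbove k = ![0,1,2] k := by decide
  simp only [h1, h2, h3, a0, a1, a2, a3, Matrix.cons_val, Fin.val_zero, Fin.val_one, Fin.val_two,
    show ((3 : Fin 4) : ℕ) = 3 from rfl]
  ring

/-- The Pfaffian is multiplied by the determinant of a real change of basis, and on `c 0, i c 0, c
1, i c 1` the Pfaffian of `Im H` equals `det H`. -/
theorem pfaffian_im (c : Basis (Fin 2) ℂ V) {H : V →ₗ[ℂ] V →ₗ⋆[ℂ] ℂ} (hH : IsHermitian H)
    (v : Fin 4 → V) :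
    (H (v 0) (v 1)).im * (H (v 2) (v 3)).im - (H (v 0) (v 2)).im * (H (v 1) (v 3)).im +
      (H (v 0) (v 3)).im * (H (v 1) (v 2)).im = realDet c v * hermDet c H := by
  rw [hH.im_apply c (v 0) (v 1), hH.im_apply c (v 2) (v 3), hH.im_apply c (v 0) (v 2),
    hH.im_apply c (v 1) (v 3), hH.im_apply c (v 0) (v 3), hH.im_apply c (v 1) (v 2)]
  simp only [realDet, hermDet, det_four, Matrix.of_apply, Matrix.cons_val]
  ring

theorem hermDet_pos (c : Basis (Fin 2) ℂ V) {P : V →ₗ[ℂ] V →ₗ⋆[ℂ] ℂ} (hP : IsHermitian P)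
    (hpos : ∀ x, x ≠ 0 → 0 < (P x x).re) : 0 < (P (c 0) (c 0)).re ∧ 0 < hermDet c P := by
  have h0 := hpos _ (c.ne_zero 0)
  refine ⟨h0, ?_⟩
  -- This is `P (c 0) (c 0)` times the projection of `c 1` to the complement of `c 0`; its norm is
  -- `P (c 0) (c 0)` times the determinant.
  have h1 := hpos (P (c 0) (c 0) • c 1 - P (c 1) (c 0) • c 0) (fun h => by
    have := congrArg (fun z => c.repr z 1) h
    simp at this
    rw [this] at h0
    simp at h0)
  rw [hP.apply_eq c, hP (c 0) (c 1)] at h1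
  simp [hP.im_self] at h1
  have h2 : 0 < (P (c 0) (c 0)).re * hermDet c P := by
    unfold hermDet
    linear_combination h1
  exact pos_of_mul_pos_right h2 h0.le

/-- The reversed Cauchy-Schwarz inequality for Hermitian forms. -/
theorem hermDet_polar (c : Basis (Fin 2) ℂ V) {P H : V →ₗ[ℂ] V →ₗ⋆[ℂ] ℂ} (hP : IsHermitian P)
    (hpos : ∀ x, x ≠ 0 → 0 < (P x x).re) (hH : IsHermitian H)
    (hle : (hermDet c (P + H) - hermDet c P - hermDet c H) ^ 2 ≤ 4 * hermDet c P * hermDet c H) :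
    ∃ r : ℝ, ∀ x y, (H x y).im = r * (P x y).im := by
  obtain ⟨h0, hd⟩ := hermDet_pos c hP hpos
  have e1 : hermDet c (P + H) - hermDet c P - hermDet c H =
      (P (c 0) (c 0)).re * (H (c 1) (c 1)).re + (H (c 0) (c 0)).re * (P (c 1) (c 1)).re
      - 2 * (P (c 0) (c 1)).re * (H (c 0) (c 1)).re - 2 * (P (c 0) (c 1)).im * (H (c 0) (c 1)).im := by
    simp [hermDet]
    ring
  rw [e1] at hle
  have hp2 : hermDet c P = (P (c 0) (c 0)).re * (P (c 1) (c 1)).re - (P (c 0) (c 1)).re ^ 2 -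
    (P (c 0) (c 1)).im ^ 2 := rfl
  have hh2 : hermDet c H = (H (c 0) (c 0)).re * (H (c 1) (c 1)).re - (H (c 0) (c 1)).re ^ 2 -
    (H (c 0) (c 1)).im ^ 2 := rfl
  have hPH : ∀ x y, (P x y).im = _ := hP.im_apply c
  have hHH : ∀ x y, (H x y).im = _ := hH.im_apply c
  generalize hermDet c P = dP at *
  generalize hermDet c H = dH at *
  generalize (P (c 0) (c 0)).re = p1 at *
  generalize (P (c 1) (c 1)).re = p2 at *
  generalize (P (c 0) (c 1)).re = px at *
  generalize (P (c 0) (c 1)).im = py at *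
  generalize (H (c 0) (c 0)).re = h1 at *
  generalize (H (c 1) (c 1)).re = h2 at *
  generalize (H (c 0) (c 1)).re = hx at *
  generalize (H (c 0) (c 1)).im = hy at *
  set B := p1 * h2 + h1 * p2 - 2 * px * hx - 2 * py * hy with hB
  -- Completing squares exhibits the determinant on Hermitian `2 × 2` matrices as Lorentzian; with
  -- `dP > 0` the hypothesis makes every square vanish, that is, `p1 H = h1 P`.
  have key : (B * p1 - 2 * h1 * dP) ^ 2 + 4 * dP * ((p1 * hx - h1 * px) ^ 2 +
      (p1 * hy - h1 * py) ^ 2) = p1 ^ 2 * (B ^ 2 - 4 * dP * dH) := by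
    rw [hB, hp2, hh2]; ring
  have hle' : p1 ^ 2 * (B ^ 2 - 4 * dP * dH) ≤ 0 :=
    mul_nonpos_of_nonneg_of_nonpos (sq_nonneg _) (by linarith)
  have n1 := sq_nonneg (B * p1 - 2 * h1 * dP)
  have n2 := mul_nonneg hd.le (sq_nonneg (p1 * hx - h1 * px))
  have n3 := mul_nonneg hd.le (sq_nonneg (p1 * hy - h1 * py))
  have key' : (B * p1 - 2 * h1 * dP) ^ 2 + 4 * (dP * (p1 * hx - h1 * px) ^ 2) +
      4 * (dP * (p1 * hy - h1 * py) ^ 2) ≤ 0 := by linarith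
  have z1 : B * p1 - 2 * h1 * dP = 0 :=
    (pow_eq_zero_iff two_ne_zero).mp (le_antisymm (by linarith) n1)
  have z2 : p1 * hx - h1 * px = 0 := (pow_eq_zero_iff two_ne_zero).mp
    ((mul_eq_zero.mp (le_antisymm (by linarith) n2)).resolve_left hd.ne')
  have z3 : p1 * hy - h1 * py = 0 := (pow_eq_zero_iff two_ne_zero).mp
    ((mul_eq_zero.mp (le_antisymm (by linarith) n3)).resolve_left hd.ne')
  have z4 : p1 * h2 = h1 * p2 := by
    apply mul_left_cancel₀ h0.ne'
    rw [hB, hp2] at z1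
    linear_combination z1 + 2 * px * z2 + 2 * py * z3
  refine ⟨h1 / p1, fun x y => ?_⟩
  rw [hPH, hHH]
  field_simp
  linear_combination (((c.repr x 1).im * (c.repr y 1).re - (c.repr x 1).re * (c.repr y 1).im)) * z4 +
    ((c.repr x 0).im * (c.repr y 1).re - (c.repr x 0).re * (c.repr y 1).im +
        (c.repr x 1).im * (c.repr y 0).re - (c.repr x 1).re * (c.repr y 0).im) * z2 +
      ((c.repr x 0).re * (c.repr y 1).re + (c.repr x 0).im * (c.repr y 1).im -
        (c.repr x 1).re * (c.repr y 0).re - (c.repr x 1).im * (c.repr y 0).im) * z3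

/-- A Hermitian form with integral imaginary part on `Λ` gives a class in `NS(X)`. -/
theorem exists_mem_NS {Λ : Submodule ℤ V} {H : V →ₗ[ℂ] V →ₗ⋆[ℂ] ℂ} (hH : IsHermitian H)
    (hint : ∀ x y : Λ, ∃ n : ℤ, (H x y).im = n) :
    ∃ E : NS Λ, ∀ x y : Λ, (H x y).im = (E : H2 Λ) ![x, y] := by
  choose f hf using hint
  have hadd : ∀ x y z, f (x + y) z = f x z + f y z := fun x y z => by
    have h := hf (x + y) z
    rw [Submodule.coe_add, map_add, LinearMap.add_apply, Complex.add_im, hf, hf] at h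
    exact_mod_cast h.symm
  have hneg : ∀ x y, f y x = -f x y := fun x y => by
    have h := hf y x
    rw [hH x y, Complex.conj_im, hf] at h
    exact_mod_cast h.symm
  have hsmul : ∀ (n : ℤ) x z, f (n • x) z = n * f x z := fun n x z => by
    have h := hf (n • x) z
    rw [Submodule.coe_smul, map_zsmul, LinearMap.smul_apply, zsmul_eq_mul, ← Complex.ofReal_intCast,
      Complex.im_ofReal_mul, hf] at h
    exact_mod_cast h.symm
  have hadd' : ∀ x y z, f z (x + y) = f z x + f z y := fun x y z => by
    rw [hneg (x + y), hadd, hneg x, hneg y]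
    ring
  have hsmul' : ∀ (n : ℤ) x z, f z (n • x) = n * f z x := fun n x z => by
    rw [hneg (n • x), hsmul, hneg x]
    ring
  let E : H2 Λ :=
    { toFun := fun v => f (v 0) (v 1)
      map_update_add' := fun m i x y => by
        fin_cases i
        · simp [hadd]
        · simp [hadd']
      map_update_smul' := fun m i n x => by
        fin_cases i
        · simp [hsmul]
        · simp [hsmul']
      map_eq_zero_of_eq' := fun v i j hv hij => by
        have h01 : v 0 = v 1 := by
          fin_cases i <;> fin_cases j <;> first | exact hv | exact hv.symm | exact absurd rfl hij
        have := hneg (v 1) (v 1)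
        simp only [h01]
        omega }
  exact ⟨⟨E, H, hH, hf⟩, hf⟩
end

section
variable {V : Type*} [NormedAddCommGroup V] [NormedSpace ℂ V]
  [Fact (finrank ℂ V = 2)] (Λ : Submodule ℤ V) [DiscreteTopology Λ] [IsZLattice ℝ Λ]

/-- The intersection number is twice the Pfaffian on an oriented basis. The constant `ρ` is the real
determinant of that basis, positive by orientation. -/
theorem exists_nsForm_eq_hermDet :
    ∃ (c : Basis (Fin 2) ℂ V) (ρ : ℝ), 0 < ρ ∧ ∀ (E : NS Λ) (H : V →ₗ[ℂ] V →ₗ⋆[ℂ] ℂ),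
      IsHermitian H → (∀ x y : Λ, (H x y).im = (E : H2 Λ) ![x, y]) →
        (nsForm Λ E E : ℝ) = 2 * (ρ * hermDet c H) := by
  obtain ⟨c, hc⟩ := (exists_isOriented Λ).choose_spec
  refine ⟨c, _, hc, fun E H hH hE => ?_⟩
  rw [← pfaffian_im c hH]
  simp only [hE]
  have h : nsForm Λ E E = _ := intersectionForm_self Λ E
  rw [h]
  simp only [h2Equiv, quadU3]
  simp
  ring

/-- The Hodge index theorem for abelian surfaces. -/
theorem hodge_index (hX : IsAbelian Λ) :
    ∃ P : NS Λ, ∀ E : NS Λ, (∀ m n : ℤ, n • E = m • P → n = 0) →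
      nsForm Λ P P * nsForm Λ E E < nsForm Λ P E ^ 2 := by
  obtain ⟨P, hP, hpos, hint⟩ := hX
  obtain ⟨EP, hEP⟩ := exists_mem_NS hP hint
  obtain ⟨c, ρ, hρ, hform⟩ := exists_nsForm_eq_hermDet Λ
  refine ⟨EP, fun E hE => ?_⟩
  by_contra! hle
  obtain ⟨H, hH, hHE⟩ := E.2
  have h1 := hform EP P hP hEP
  have h2 := hform E H hH hHE
  have h3 := hform (EP + E) (P + H) (fun x y => by simp [hP x y, hH x y]) (fun x y => by
    simp [hEP, hHE])
  have h4 := (nsForm_isSymm Λ).eq EP E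
  simp only [map_add, LinearMap.add_apply] at h3 h4
  rw [h4] at h3
  push_cast at h3
  have h5 : (nsForm Λ EP E : ℝ) = ρ * (hermDet c (P + H) - hermDet c P - hermDet c H) := by
    rw [h1, h2] at h3
    have : (nsForm Λ E EP : ℝ) = (nsForm Λ EP E : ℝ) := by exact_mod_cast h4.symm
    linarith
  have hle' : (nsForm Λ EP E : ℝ) ^ 2 ≤ nsForm Λ EP EP * nsForm Λ E E := by exact_mod_cast hle
  rw [h5, h1, h2] at hle'
  have hρ2 : 0 < ρ ^ 2 := by positivity
  obtain ⟨r, hr⟩ := hermDet_polar c hP hpos hH (by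
    apply le_of_mul_le_mul_left _ hρ2
    linarith)
  have hne : (EP : H2 Λ) ≠ 0 := by
    intro h0
    have h6 : nsForm Λ EP EP = 0 := by
      rw [show EP = 0 from Subtype.ext h0, map_zero]
    rw [h6, Int.cast_zero] at h1
    have := mul_pos hρ (hermDet_pos c hP hpos).2
    linarith
  obtain ⟨v, hv⟩ := DFunLike.ne_iff.mp hne
  have hvec : ∀ w : Fin 2 → Λ, w = ![w 0, w 1] := fun w => by
    ext i; fin_cases i <;> rfl
  -- Real proportionality of `E` and `EP` gives the integral relation `EP(v) E = E(v) EP`,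
  -- contradicting independence when `EP(v) ≠ 0`.
  refine hv (hE ((E : H2 Λ) v) ((EP : H2 Λ) v) (Subtype.ext (AlternatingMap.ext fun w => ?_)))
  have e1 := hr (v 0) (v 1)
  have e2 := hr (w 0) (w 1)
  rw [hHE, hEP, ← hvec] at e1 e2
  have : ((EP : H2 Λ) v : ℝ) * ((E : H2 Λ) w : ℝ) = ((E : H2 Λ) v : ℝ) * ((EP : H2 Λ) w : ℝ) := by
    rw [e1, e2]; ring
  exact_mod_cast this

/-- If the `i`-th coordinate of the class `P` is nonzero, the other basis vector is independent of
`P`. Hodge index for that pair is the negativity of its Gram determinant, which is minus the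
discriminant times the square of that coordinate. -/
theorem discr_pos (hX : IsAbelian Λ) {b : Basis (Fin 2) ℤ (NS Λ)} {A B C : ℤ}
    (h : HasGram (nsForm Λ) b A B C) : 0 < B ^ 2 - 4 * A * C := by
  obtain ⟨P, hP⟩ := hodge_index Λ hX
  have hrel : ∀ i, b.repr P i ≠ 0 → ∀ j, j ≠ i → ∀ m n : ℤ, n • b j = m • P → n = 0 := by
    intro i hi j hj m n hmn
    have h1 := congrArg (fun z => b.repr z i) hmn
    have h2 := congrArg (fun z => b.repr z j) hmn
    simp [hj, hi] at h1 h2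
    rw [h2, h1, zero_mul]
  by_cases h0 : b.repr P 0 = 0
  -- For `P = 0` the strict inequality would read `0 < 0`.
  · by_cases h1 : b.repr P 1 = 0
    · have hP0 : P = 0 := by
        rw [← b.sum_repr P, Fin.sum_univ_two, h0, h1, zero_smul, zero_smul, add_zero]
      have h3 := hP (b 0) fun m n hmn => by
        have h1 := congrArg (fun z => b.repr z 0) hmn
        simpa [hP0] using h1
      rw [hP0] at h3
      simp at h3
    · have h2 := hP (b 0) (hrel 1 h1 0 (by decide))
      simp only [h.apply] at h2
      simp [h0] at h2
      exact pos_of_mul_pos_right (a := b.repr P 1 ^ 2) (by linarith) (sq_nonneg _)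
  · have h2 := hP (b 1) (hrel 0 h0 1 (by decide))
    simp only [h.apply] at h2
    simp at h2
    exact pos_of_mul_pos_right (a := b.repr P 0 ^ 2) (by linarith) (sq_nonneg _)

/-- A basis of `NS(X)` with non-isotropic first vector. -/
theorem exists_basis_NS (hX : IsAbelian Λ) (hρ : picardNumber Λ = 2) :
    ∃ b : Basis (Fin 2) ℤ (NS Λ), nsForm Λ (b 0) (b 0) ≠ 0 := by
  have : Module.Free ℤ (H2 Λ) :=
    Module.Free.of_equiv (h2Equiv (exists_isOriented Λ).choose).symm
  have : Module.Finite ℤ (H2 Λ) :=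
    Module.Finite.equiv (h2Equiv (exists_isOriented Λ).choose).symm
  let b : Basis (Fin 2) ℤ (NS Λ) := finBasisOfFinrankEq ℤ (NS Λ) hρ
  obtain ⟨A, hA⟩ := nsForm_even Λ (b 0)
  obtain ⟨C, hC⟩ := nsForm_even Λ (b 1)
  have h : HasGram (nsForm Λ) b A (nsForm Λ (b 0) (b 1)) C :=
    ⟨by linarith, rfl, (nsForm_isSymm Λ).eq (b 1) (b 0), by linarith⟩
  have hd := discr_pos Λ hX h
  by_cases hA0 : A = 0
  · by_cases hC0 : C = 0
    · obtain ⟨b', hb', -⟩ := exists_basis_change b 1 1 0 1 (by simp)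
      refine ⟨b', fun h0 => ?_⟩
      rw [h.apply, hb'] at h0
      simp [hA0, hC0] at h0
      simp [hA0, hC0, h0] at hd
    · obtain ⟨b', hb', -⟩ := exists_basis_change b 0 1 1 0 (by simp)
      refine ⟨b', fun h0 => ?_⟩
      rw [h.apply, hb'] at h0
      simp [hC0] at h0
  · exact ⟨b, by rw [hA]; omega⟩
end

/-! ### Primary components of the discriminant group. -/

theorem eq_zsmul_add_zsmul_of_coprime {G : Type*} [AddCommGroup G] {g x y : G} {t s P u c d : ℤ}
    (h : t * P + s * u = 1) (h0 : P • g = 0) (h1 : u • g = c • x + d • y) :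
    g = (s * c) • x + (s * d) • y := by
  rw [mul_smul, mul_smul, ← smul_add, ← h1, ← mul_smul]
  calc g = (t * P + s * u) • g := by rw [h, one_smul]
    _ = (s * u) • g := by rw [add_smul, mul_smul, h0, smul_zero, zero_add]

theorem exists_equiv_zmod_prod {G : Type*} [AddCommGroup G] (m n : ℕ) (x y : G)
    (hker : ∀ a b : ℤ, a • x + b • y = 0 ↔ (m : ℤ) ∣ a ∧ (n : ℤ) ∣ b)
    (hsurj : ∀ g : G, ∃ a b : ℤ, g = a • x + b • y) :
    ∃ e : G ≃+ ZMod m × ZMod n, ∀ a b : ℤ, e.symm ((a : ZMod m), (b : ZMod n)) = a • x + b • y := by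
  have hx : (zmultiplesHom G x) (m : ℤ) = 0 := by
    have := (hker m 0).mpr ⟨dvd_rfl, dvd_zero _⟩
    simpa using this
  have hy : (zmultiplesHom G y) (n : ℤ) = 0 := by
    have := (hker 0 n).mpr ⟨dvd_zero _, dvd_rfl⟩
    simpa using this
  let f : ZMod m × ZMod n →+ G :=
    (ZMod.lift m ⟨zmultiplesHom G x, hx⟩).coprod (ZMod.lift n ⟨zmultiplesHom G y, hy⟩)
  have hf : ∀ a b : ℤ, f ((a : ZMod m), (b : ZMod n)) = a • x + b • y := fun a b => by
    simp [f]
  have hbij : Function.Bijective f := by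
    constructor
    · rw [injective_iff_map_eq_zero]
      rintro ⟨a, b⟩ hab
      obtain ⟨a, rfl⟩ := ZMod.intCast_surjective a
      obtain ⟨b, rfl⟩ := ZMod.intCast_surjective b
      rw [hf, hker, ← ZMod.intCast_zmod_eq_zero_iff_dvd, ← ZMod.intCast_zmod_eq_zero_iff_dvd] at hab
      exact Prod.ext hab.1 hab.2
    · intro g
      obtain ⟨a, b, rfl⟩ := hsurj g
      exact ⟨_, hf a b⟩
  exact ⟨(AddEquiv.ofBijective f hbij).symm, hf⟩

section
variable {M : Type*} [AddCommGroup M] {β : LinearMap.BilinForm ℤ M}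

theorem exists_tmul_basis (b : Basis (Fin 2) ℤ M) (x : ℚ ⊗[ℤ] M) :
    ∃ r s : ℚ, x = r ⊗ₜ[ℤ] b 0 + s ⊗ₜ[ℤ] b 1 := by
  induction x with
  | zero => exact ⟨0, 0, by simp⟩
  | add x y hx hy =>
    obtain ⟨r, s, rfl⟩ := hx
    obtain ⟨r', s', rfl⟩ := hy
    exact ⟨r + r', s + s', by rw [TensorProduct.add_tmul, TensorProduct.add_tmul]; abel⟩
  | tmul a m =>
    refine ⟨b.repr m 0 • a, b.repr m 1 • a, ?_⟩
    conv_lhs => rw [← b.sum_repr m]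
    rw [Fin.sum_univ_two, TensorProduct.tmul_add, TensorProduct.smul_tmul, TensorProduct.smul_tmul]

theorem ratForm_toRat (β : LinearMap.BilinForm ℤ M) (a : ℚ) (x y : M) :
    ratForm β (a ⊗ₜ[ℤ] x) (toRat M y) = a * (β x y : ℚ) := by
  have h := ratForm_tmul β a 1 x y
  rw [mul_one] at h
  exact h

theorem eq_zero_of_ratForm {b : Basis (Fin 2) ℤ M} {A B C : ℤ} (hg : HasGram β b A B C)
    (hΔ : B ^ 2 - 4 * A * C ≠ 0) {x : ℚ ⊗[ℤ] M}
    (h0 : ratForm β x (toRat M (b 0)) = 0) (h1 : ratForm β x (toRat M (b 1)) = 0) : x = 0 := by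
  obtain ⟨r, s, rfl⟩ := exists_tmul_basis b x
  rw [map_add, LinearMap.add_apply, ratForm_toRat, ratForm_toRat] at h0 h1
  rw [hg.1, hg.2.2.1] at h0
  rw [hg.2.1, hg.2.2.2] at h1
  push_cast at h0 h1
  have hΔ' : ((B : ℚ) ^ 2 - 4 * A * C) ≠ 0 := by exact_mod_cast hΔ
  have hr : r = 0 := by
    apply (mul_eq_zero.mp (?_ : ((B : ℚ) ^ 2 - 4 * A * C) * r = 0)).resolve_left hΔ'
    linear_combination B * h1 - 2 * C * h0
  have hs : s = 0 := by
    apply (mul_eq_zero.mp (?_ : ((B : ℚ) ^ 2 - 4 * A * C) * s = 0)).resolve_left hΔ'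
    linear_combination B * h0 - 2 * A * h1
  rw [hr, hs, TensorProduct.zero_tmul, TensorProduct.zero_tmul, add_zero]

theorem eq_zero_of_ratForm_of_gram {b : Basis (Fin 2) ℤ M} {A B C : ℤ} (hg : HasGram β b A B C)
    {p₁ p₂ : M} (hdet : β p₁ p₁ * β p₂ p₂ - β p₁ p₂ * β p₂ p₁ ≠ 0) {x : ℚ ⊗[ℤ] M}
    (h1 : ratForm β x (toRat M p₁) = 0) (h2 : ratForm β x (toRat M p₂) = 0) : x = 0 := by
  set s := b.repr p₁ 0
  set t := b.repr p₁ 1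
  set s' := b.repr p₂ 0
  set t' := b.repr p₂ 1
  have e : β p₁ p₁ * β p₂ p₂ - β p₁ p₂ * β p₂ p₁ =
      - (s * t' - t * s') ^ 2 * (B ^ 2 - 4 * A * C) := by
    rw [hg.apply, hg.apply, hg.apply, hg.apply]; ring
  rw [e] at hdet
  have hd : ((s * t' - t * s' : ℤ) : ℚ) ≠ 0 := by
    intro h
    apply hdet
    rw [Int.cast_eq_zero.mp h]; ring
  have hp : ∀ q : M, ratForm β x (toRat M q) = b.repr q 0 * ratForm β x (toRat M (b 0)) +
      b.repr q 1 * ratForm β x (toRat M (b 1)) := by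
    intro q
    conv_lhs => rw [← b.sum_repr q]
    simp only [Fin.sum_univ_two, map_add, map_zsmul, zsmul_eq_mul]
  rw [hp] at h1 h2
  refine eq_zero_of_ratForm hg (right_ne_zero_of_mul hdet) ?_ ?_
  · apply (mul_eq_zero.mp (?_ : ((s * t' - t * s' : ℤ) : ℚ) * _ = 0)).resolve_left hd
    push_cast
    linear_combination t' * h1 - t * h2
  · apply (mul_eq_zero.mp (?_ : ((s * t' - t * s' : ℤ) : ℚ) * _ = 0)).resolve_left hd
    push_cast
    linear_combination s * h2 - s' * h1

/-- The primary component of the discriminant group in terms of a `p`-adic basis that splits the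
form. -/
theorem exists_primaryComponent_equiv (hs : β.IsSymm) (he : ∀ x, Even (β x x))
    {b : Basis (Fin 2) ℤ M} {A B C : ℤ} (hg : HasGram β b A B C) {p : ℕ} (hp : p.Prime)
    (k e : ℕ) {p₁ p₂ : M} {α ν γ : ℤ}
    (h11 : β p₁ p₁ = p ^ k * α) (h12 : β p₁ p₂ = p ^ (k + e) * ν) (h22 : β p₂ p₂ = p ^ (k + e) * γ)
    (h1 : ∀ x, (p : ℤ) ^ k ∣ β p₁ x) (h2 : ∀ x, (p : ℤ) ^ (k + e) ∣ β p₂ x)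
    (hu : ¬ (p : ℤ) ∣ α * γ - p ^ e * ν ^ 2) :
    ∃ f : AddCommGroup.primaryComponent (DiscGroup β) p ≃+ ZMod (p ^ k) × ZMod (p ^ (k + e)),
      ∀ a₁ a₂ : ℤ, discForm β hs he (f.symm ((a₁ : ZMod (p ^ k)), (a₂ : ZMod (p ^ (k + e))))) =
        ((α * a₁ ^ 2 / p ^ k + 2 * ν * (a₁ * a₂) / p ^ k + γ * a₂ ^ 2 / p ^ (k + e) : ℚ) :
          AddCircle (2 : ℚ)) := by
  have hp0 : (p : ℚ) ≠ 0 := Nat.cast_ne_zero.mpr hp.ne_zero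
  have hpk : ∀ j : ℕ, (p : ℚ) ^ j ≠ 0 := fun j => pow_ne_zero j hp0
  have h21 : β p₂ p₁ = p ^ (k + e) * ν := by rw [← h12]; exact (hs.eq p₁ p₂).symm
  set u : ℤ := α * γ - p ^ e * ν ^ 2 with hudef
  have hdual : ∀ (j : ℕ) (q : M), (∀ x, (p : ℤ) ^ j ∣ β q x) →
      ((p : ℚ) ^ j)⁻¹ ⊗ₜ[ℤ] q ∈ dualLattice β := by
    intro j q hq m
    obtain ⟨n, hn⟩ := hq m
    refine ⟨n, ?_⟩
    rw [ratForm_toRat, hn]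
    push_cast
    rw [inv_mul_cancel_left₀ (hpk j)]
  have hmul : ∀ (j : ℕ) (q : M) (c : ℤ),
      ((p : ℤ) ^ j * c) • (((p : ℚ) ^ j)⁻¹ ⊗ₜ[ℤ] q) = toRat M (c • q) := by
    intro j q c
    rw [TensorProduct.smul_tmul', zsmul_eq_mul]
    push_cast
    rw [mul_right_comm, mul_inv_cancel₀ (hpk j), one_mul]
    change _ = (1 : ℚ) ⊗ₜ[ℤ] (c • q)
    rw [← TensorProduct.smul_tmul, zsmul_eq_mul, mul_one]
  set w₁ : dualLattice β := ⟨_, hdual k p₁ h1⟩ with hw₁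
  set w₂ : dualLattice β := ⟨_, hdual (k + e) p₂ h2⟩ with hw₂
  have hmem : ∀ (j : ℕ) (q : M) (hq : ∀ x, (p : ℤ) ^ j ∣ β q x),
      ((⟨_, hdual j q hq⟩ : dualLattice β) : DiscGroup β) ∈
        AddCommGroup.primaryComponent (DiscGroup β) p := by
    intro j q hq
    rw [AddCommGroup.mem_primaryComponent]
    refine ⟨j, ?_⟩
    rw [← QuotientAddGroup.mk_nsmul, QuotientAddGroup.eq_zero_iff, AddSubgroup.mem_addSubgroupOf]
    refine ⟨q, ?_⟩
    have := hmul j q 1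
    rw [mul_one, one_zsmul] at this
    rw [← this]
    simp only [AddSubgroup.coe_nsmul]
    rw [← natCast_zsmul]
    push_cast
    rfl
  set x₁ : AddCommGroup.primaryComponent (DiscGroup β) p := ⟨_, hmem k p₁ h1⟩ with hx₁
  set x₂ : AddCommGroup.primaryComponent (DiscGroup β) p := ⟨_, hmem (k + e) p₂ h2⟩ with hx₂
  have hpair₁ : ∀ a c : ℤ, ratForm β (a • (w₁ : ℚ ⊗[ℤ] M) + c • (w₂ : ℚ ⊗[ℤ] M)) (toRat M p₁) =
      a * α + c * ν := by
    intro a c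
    rw [map_add, map_zsmul, map_zsmul, LinearMap.add_apply, LinearMap.smul_apply,
      LinearMap.smul_apply, hw₁, hw₂, ratForm_toRat, ratForm_toRat, h11, h21]
    push_cast
    rw [inv_mul_cancel_left₀ (hpk _), inv_mul_cancel_left₀ (hpk _), zsmul_eq_mul, zsmul_eq_mul]
  have hpair₂ : ∀ a c : ℤ, ratForm β (a • (w₁ : ℚ ⊗[ℤ] M) + c • (w₂ : ℚ ⊗[ℤ] M)) (toRat M p₂) =
      a * (p ^ e * ν) + c * γ := by
    intro a c
    rw [map_add, map_zsmul, map_zsmul, LinearMap.add_apply, LinearMap.smul_apply,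
      LinearMap.smul_apply, hw₁, hw₂, ratForm_toRat, ratForm_toRat, h12, h22]
    push_cast
    rw [pow_add, mul_assoc, inv_mul_cancel_left₀ (hpk _), ← pow_add, inv_mul_cancel_left₀ (hpk _),
      zsmul_eq_mul, zsmul_eq_mul]
  have hcop : ∀ r : ℕ, IsCoprime ((p : ℤ) ^ r) u := fun r =>
    IsCoprime.pow_left ((Nat.prime_iff_prime_int.mp hp).coprime_iff_not_dvd.mpr hu)
  have hlift : ∀ a c : ℤ, ((a • x₁ + c • x₂ : AddCommGroup.primaryComponent (DiscGroup β) p) :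
      DiscGroup β) = ((a • w₁ + c • w₂ : dualLattice β) : DiscGroup β) := fun a c => rfl
  obtain ⟨f, hf⟩ := exists_equiv_zmod_prod (p ^ k) (p ^ (k + e)) x₁ x₂ (fun a c => by
    rw [← Subtype.coe_inj, hlift, ZeroMemClass.coe_zero, QuotientAddGroup.eq_zero_iff,
      AddSubgroup.mem_addSubgroupOf]
    push_cast
    constructor
    · rintro ⟨m, hm⟩
      change toRat M m = a • (w₁ : ℚ ⊗[ℤ] M) + c • (w₂ : ℚ ⊗[ℤ] M) at hm
      have e1 := hpair₁ a c
      have e2 := hpair₂ a c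
      rw [← hm] at e1 e2
      have hm' : ∀ q, ratForm β (toRat M m) (toRat M q) = β m q := fun q => by
        have := ratForm_toRat β 1 m q
        rwa [one_mul] at this
      rw [hm'] at e1 e2
      have e1' : β m p₁ = a * α + c * ν := by exact_mod_cast e1
      have e2' : β m p₂ = a * (p ^ e * ν) + c * γ := by exact_mod_cast e2
      obtain ⟨y1, hy1⟩ := h1 m
      obtain ⟨y2, hy2⟩ := h2 m
      have hy1' : β m p₁ = p ^ k * y1 := by rw [← hy1]; exact (hs.eq p₁ m).symm
      have hy2' : β m p₂ = p ^ (k + e) * y2 := by rw [← hy2]; exact (hs.eq p₂ m).symm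
      -- Pairing a relation with `p₁` and `p₂` gives a linear system of determinant `u`; Cramer's
      -- rule bounds `u a` and `u c`, and `u` is prime to `p`.
      refine ⟨(hcop k).dvd_of_dvd_mul_right ⟨γ * y1 - p ^ e * ν * y2, ?_⟩,
        (hcop (k + e)).dvd_of_dvd_mul_right ⟨α * y2 - ν * y1, ?_⟩⟩
      · rw [hy1'] at e1'
        rw [hy2'] at e2'
        rw [pow_add] at e2'
        rw [hudef]
        linear_combination -γ * e1' + ν * e2'
      · rw [hy1'] at e1'
        rw [hy2'] at e2'
        rw [pow_add] at e2' ⊢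
        rw [hudef]
        linear_combination -α * e2' + p ^ e * ν * e1'
    · rintro ⟨⟨a, rfl⟩, ⟨c, rfl⟩⟩
      refine ⟨a • p₁ + c • p₂, ?_⟩
      rw [map_add, ← hmul k, ← hmul (k + e)]) (fun g => by
    obtain ⟨g, hgp⟩ := g
    obtain ⟨x, rfl⟩ := QuotientAddGroup.mk_surjective g
    obtain ⟨r, hr⟩ := AddCommGroup.mem_primaryComponent.mp hgp
    obtain ⟨n1, hn1⟩ := x.2 p₁
    obtain ⟨n2, hn2⟩ := x.2 p₂
    set c1 : ℤ := γ * n1 - ν * n2 with hc1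
    set c2 : ℤ := α * n2 - p ^ e * ν * n1 with hc2
    -- Cramer's rule again: both sides have the same pairings with `p₁` and `p₂`, which determine a
    -- rational vector. On an element killed by `p ^ r` the factor `u` is then inverted by Bézout.
    have hx : u • (x : ℚ ⊗[ℤ] M) = c1 • (w₁ : ℚ ⊗[ℤ] M) + c2 • (w₂ : ℚ ⊗[ℤ] M) := by
      rw [← sub_eq_zero]
      refine eq_zero_of_ratForm_of_gram hg (p₁ := p₁) (p₂ := p₂) ?_ ?_ ?_
      · rw [h11, h12, h21, h22]
        have : (p : ℤ) ^ k * α * (p ^ (k + e) * γ) - p ^ (k + e) * ν * (p ^ (k + e) * ν) =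
            p ^ k * p ^ (k + e) * u := by rw [hudef, pow_add]; ring
        rw [this]
        have hpz : (p : ℤ) ≠ 0 := Nat.cast_ne_zero.mpr hp.ne_zero
        refine mul_ne_zero (mul_ne_zero (pow_ne_zero _ hpz) (pow_ne_zero _ hpz)) ?_
        rintro h0
        exact hu (h0 ▸ dvd_zero _)
      · rw [map_sub, LinearMap.sub_apply, hpair₁, map_zsmul, LinearMap.smul_apply, hn1,
          zsmul_eq_mul, hudef, hc1, hc2]
        push_cast
        ring
      · rw [map_sub, LinearMap.sub_apply, hpair₂, map_zsmul, LinearMap.smul_apply, hn2,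
          zsmul_eq_mul, hudef, hc1, hc2]
        push_cast
        ring
    have hx' : u • (x : DiscGroup β) = c1 • (w₁ : DiscGroup β) + c2 • (w₂ : DiscGroup β) := by
      have : u • x = c1 • w₁ + c2 • w₂ := Subtype.ext hx
      exact congrArg (QuotientAddGroup.mk (s := (toRat M).range.addSubgroupOf (dualLattice β))) this
    obtain ⟨t, s, hts⟩ := hcop r
    refine ⟨s * c1, s * c2, Subtype.ext ?_⟩
    rw [hlift]
    change (x : DiscGroup β) = (s * c1) • (w₁ : DiscGroup β) + (s * c2) • (w₂ : DiscGroup β)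
    have hr' : ((p : ℤ) ^ r) • (x : DiscGroup β) = 0 := by
      rw [← hr, ← natCast_zsmul]
      push_cast
      rfl
    exact eq_zsmul_add_zsmul_of_coprime hts hr' hx')
  refine ⟨f, fun a₁ a₂ => ?_⟩
  rw [hf, hlift]
  have hq : discForm β hs he ((a₁ • w₁ + a₂ • w₂ : dualLattice β) : DiscGroup β) =
      ((ratForm β (a₁ • (w₁ : ℚ ⊗[ℤ] M) + a₂ • (w₂ : ℚ ⊗[ℤ] M))
        (a₁ • (w₁ : ℚ ⊗[ℤ] M) + a₂ • (w₂ : ℚ ⊗[ℤ] M)) : ℚ) : AddCircle (2 : ℚ)) := rfl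
  rw [hq]
  congr 1
  simp only [map_add, map_zsmul, LinearMap.add_apply, LinearMap.smul_apply, hw₁, hw₂, ratForm_tmul,
    h11, h12, h21, h22, zsmul_eq_mul]
  push_cast
  rw [pow_add]
  have := hpk k
  have := hpk e
  field_simp
  ring
end

/-! ### Invariants of the group and `2`-adic normal forms. -/

theorem addCircle_two_eq {x y : ℚ} (n : ℤ) (h : x - y = 2 * n) :
    (x : AddCircle (2 : ℚ)) = (y : AddCircle (2 : ℚ)) := by
  rw [← sub_eq_zero, ← QuotientAddGroup.mk_sub, QuotientAddGroup.eq_zero_iff,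
    AddSubgroup.mem_zmultiples_iff]
  exact ⟨n, by rw [h, zsmul_eq_mul, mul_comm]⟩

/-- The exponent of the group gives the larger factor, and the order then gives the smaller one. -/
theorem zmod_prod_exponents {p : ℕ} (hp : p.Prime) {k e l m : ℕ} (hlm : l ≤ m)
    (f : ZMod (p ^ k) × ZMod (p ^ (k + e)) ≃+ ZMod (p ^ l) × ZMod (p ^ m)) :
    k = l ∧ k + e = m := by
  have h1 := AddMonoid.exponent_eq_of_addEquiv f
  rw [AddMonoid.exponent_prod, AddMonoid.exponent_prod, ZMod.exponent, ZMod.exponent, ZMod.exponent,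
    ZMod.exponent] at h1
  have h2 : lcm (p ^ k) (p ^ (k + e)) = p ^ (k + e) :=
    Nat.lcm_eq_right (pow_dvd_pow p (Nat.le_add_right k e))
  have h3 : lcm (p ^ l) (p ^ m) = p ^ m := Nat.lcm_eq_right (pow_dvd_pow p hlm)
  rw [h2, h3] at h1
  have h4 := Nat.pow_right_injective hp.two_le h1
  have h5 := Nat.card_congr f.toEquiv
  rw [Nat.card_prod, Nat.card_prod, Nat.card_zmod, Nat.card_zmod, Nat.card_zmod, Nat.card_zmod,
    ← pow_add, ← pow_add] at h5
  have h6 := Nat.pow_right_injective hp.two_le h5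
  omega

/-- Hensel's lemma for a quadratic polynomial with odd linear term and even constant term. -/
theorem exists_root_two_pow (α β γ : ℤ) (hβ : Odd β) (hγ : Even γ) (k : ℕ) :
    ∃ x : ℤ, (2 : ℤ) ^ k ∣ α * x ^ 2 + β * x + γ := by
  suffices H : ∀ k : ℕ, ∃ x : ℤ, (2 : ℤ) ^ (k + 1) ∣ α * x ^ 2 + β * x + γ by
    obtain ⟨x, hx⟩ := H k
    exact ⟨x, (pow_dvd_pow 2 k.le_succ).trans hx⟩
  clear k
  intro k
  induction k with
  | zero => exact ⟨0, by simpa using hγ.two_dvd⟩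
  | succ k ih =>
    obtain ⟨x, m, hm⟩ := ih
    obtain ⟨j, hj⟩ := hβ
    -- A Newton step: the derivative is odd, so modulo `2` the error `m` is its own correction.
    refine ⟨x + 2 ^ (k + 1) * m, m * (1 + α * x + j) + α * 2 ^ k * m ^ 2, ?_⟩
    have : α * (x + 2 ^ (k + 1) * m) ^ 2 + β * (x + 2 ^ (k + 1) * m) + γ =
        (α * x ^ 2 + β * x + γ) + 2 ^ (k + 1) * m * (2 * α * x + β) + α * (2 ^ (k + 1) * m) ^ 2 := by
      ring
    rw [this, hm, hj]
    ring

theorem exists_inverse_two_pow {b : ℤ} (hb : Odd b) (k : ℕ) :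
    ∃ j : ℤ, Odd j ∧ (2 : ℤ) ^ k ∣ b * j - 1 := by
  -- The extra power of two makes `j` odd even when `k = 0`.
  have h : IsCoprime ((2 : ℤ) ^ (k + 1)) b :=
    IsCoprime.pow_left (Int.isCoprime_iff_gcd_eq_one.mpr (by
      rw [Int.gcd_comm]; exact Int.isCoprime_iff_gcd_eq_one.mp (Int.isCoprime_two_right.mpr hb)))
  obtain ⟨t, j, htj⟩ := h
  have hj : (2 : ℤ) ^ (k + 1) ∣ b * j - 1 := ⟨-t, by linear_combination htj⟩
  refine ⟨j, ?_, (pow_dvd_pow 2 k.le_succ).trans hj⟩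
  by_contra hne
  rw [Int.not_odd_iff_even] at hne
  obtain ⟨i, hi⟩ := hne.two_dvd
  obtain ⟨n, hn⟩ := hj
  rw [hi, pow_succ] at hn
  have : 2 * (b * i - 2 ^ k * n) = 1 := by linear_combination hn
  omega

/-- A `2`-adic base change into the form `θ (u x² + v x y + w y²)`, modulo `2 ^ k`. -/
def TwoAdicEquiv (k : ℕ) (a b c θ u v w : ℤ) : Prop :=
  ∃ s t s' t' : ℤ, Odd (s * t' - t * s') ∧
    (2 : ℤ) ^ k ∣ a * s ^ 2 + b * s * t + c * t ^ 2 - θ * u ∧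
    (2 : ℤ) ^ k ∣ 2 * a * s * s' + b * (s * t' + t * s') + 2 * c * t * t' - θ * v ∧
    (2 : ℤ) ^ k ∣ a * s' ^ 2 + b * s' * t' + c * t' ^ 2 - θ * w

theorem TwoAdicEquiv.swap {k : ℕ} {a b c θ u v w : ℤ} (h : TwoAdicEquiv k c b a θ u v w) :
    TwoAdicEquiv k a b c θ u v w := by
  obtain ⟨s, t, s', t', h0, h1, h2, h3⟩ := h
  refine ⟨t, s, t', s', ?_, ?_, ?_, ?_⟩
  · obtain ⟨r, hr⟩ := h0
    exact ⟨-r - 1, by linear_combination -hr⟩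
  · convert h1 using 1; ring
  · convert h2 using 1; ring
  · convert h3 using 1; ring

theorem exists_twoAdicEquiv_hyperbolic_of_even {a b c : ℤ} (hb : Odd b) (ha : Even a) (k : ℕ) :
    ∃ θ : ℤ, Odd θ ∧ TwoAdicEquiv k a b c θ 0 1 0 := by
  obtain ⟨y, m, hy⟩ := exists_root_two_pow c b a hb ha k
  have hθ : Odd (b + 2 * c * y) := hb.add_even ⟨c * y, by ring⟩
  obtain ⟨j, -, n, hj⟩ := exists_inverse_two_pow hθ k
  -- Modulo `2 ^ k`, `(1, y)` is isotropic and pairs to `θ = b + 2cy` with `(0, 1)`. Subtracting `c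
  -- θ⁻¹ (1, y)` from `(0, 1)` makes the second vector isotropic too.
  refine ⟨b + 2 * c * y, hθ, 1, y, -c * j, 1 - c * j * y, ⟨0, by ring⟩, ⟨m, ?_⟩,
    ⟨-2 * c * j * m, ?_⟩, ⟨c ^ 2 * j ^ 2 * m - c * n, ?_⟩⟩
  · linear_combination hy
  · linear_combination -2 * c * j * hy
  · linear_combination c ^ 2 * j ^ 2 * hy - c * hj

theorem exists_twoAdicEquiv_anisotropic {a b c : ℤ} (hb : Odd b) (ha : Odd a) (hc : Odd c) (k : ℕ) :
    TwoAdicEquiv k a b c a 1 1 1 := by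
  obtain ⟨j, hj, n, hn⟩ := exists_inverse_two_pow hb k
  have hw : Odd (c * a * j ^ 2) := (hc.mul ha).mul hj.pow
  -- The second vector `(x, a b⁻¹ (1 - 2x))` has polar value `a` with `(1, 0)` for every `x`.
  -- Requiring its own value to be `a` is this quadratic equation, whose constant term is even
  -- because `c a j²` is odd.
  obtain ⟨x, m, hx⟩ := exists_root_two_pow (4 * (c * a * j ^ 2) - 1) (1 - 4 * (c * a * j ^ 2))
    (c * a * j ^ 2 - 1) (odd_one.sub_even ⟨2 * (c * a * j ^ 2), by ring⟩) (hw.sub_odd odd_one) k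
  refine ⟨1, 0, x, a * j * (1 - 2 * x), ?_, ⟨0, by ring⟩, ⟨a * (1 - 2 * x) * n, ?_⟩,
    ⟨a * m + a * x * (1 - 2 * x) * n, ?_⟩⟩
  · have : Odd (a * j * (1 - 2 * x)) := (ha.mul hj).mul (odd_one.sub_even ⟨x, by ring⟩)
    convert this using 1; ring
  · linear_combination a * (1 - 2 * x) * hn
  · linear_combination a * hx + a * x * (1 - 2 * x) * hn

/-! ### Sylow subgroups of the discriminant group from a Gram matrix. -/

section
variable {M : Type*} [AddCommGroup M] {β : LinearMap.BilinForm ℤ M} {b : Basis (Fin 2) ℤ M}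

/-- A basis whose first vector has norm prime to `p`. -/
theorem exists_basis_not_dvd {g A B C : ℤ} (hg : HasGram β b (g * A) (g * B) (g * C))
    (hprim : ∀ p : ℕ, p.Prime → (p : ℤ) ∣ A → (p : ℤ) ∣ B → (p : ℤ) ∣ C → False)
    {p : ℕ} (hp : p.Prime) :
    ∃ (b' : Basis (Fin 2) ℤ M) (A' B' C' : ℤ), HasGram β b' (g * A') (g * B') (g * C') ∧
      B' ^ 2 - 4 * A' * C' = B ^ 2 - 4 * A * C ∧ ¬ (p : ℤ) ∣ A' := by
  obtain ⟨h1, h2, h3, h4⟩ := hg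
  by_cases hA : (p : ℤ) ∣ A
  · by_cases hC : (p : ℤ) ∣ C
    · have hB : ¬ (p : ℤ) ∣ B := fun hB => hprim p hp hA hB hC
      obtain ⟨b', e0, e1⟩ := exists_basis_change b 1 1 0 1 (by simp)
      refine ⟨b', A + B + C, B + 2 * C, C, ?_, by ring, fun h => hB ?_⟩
      · simp only [HasGram, e0, e1, map_add, map_zsmul, LinearMap.add_apply, LinearMap.smul_apply,
          h1, h2, h3, h4, smul_eq_mul]
        refine ⟨?_, ?_, ?_, ?_⟩ <;> ring
      · exact (dvd_sub (dvd_sub h hA) hC).trans (dvd_of_eq (by ring))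
    · obtain ⟨b', e0, e1⟩ := exists_basis_change b 0 1 1 0 (by simp)
      refine ⟨b', C, B, A, ?_, by ring, hC⟩
      simp only [HasGram, e0, e1, map_add, map_zsmul, LinearMap.add_apply, LinearMap.smul_apply,
          h1, h2, h3, h4, smul_eq_mul]
      refine ⟨?_, ?_, ?_, ?_⟩ <;> ring
  · exact ⟨b, A, B, C, ⟨h1, h2, h3, h4⟩, rfl, hA⟩

/-- Since `2A` is a `p`-adic unit, `b 0` and its orthogonal vector `-B b 0 + 2A b 1` diagonalize the
form over `ℤ_p`; the second norm carries the discriminant. -/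
theorem exists_equiv_of_odd_prime (hs : β.IsSymm) (he : ∀ x, Even (β x x)) {g A B C : ℤ}
    (hg : HasGram β b (g * A) (g * B) (g * C)) {p : ℕ} (hp : p.Prime) (hp2 : p ≠ 2) {k e : ℕ}
    {g' D' : ℤ} (hk : g = p ^ k * g') (hD : B ^ 2 - 4 * A * C = p ^ e * D') (hg' : ¬ (p : ℤ) ∣ g')
    (hD' : ¬ (p : ℤ) ∣ D') (hA : ¬ (p : ℤ) ∣ A) :
    Nonempty (AddCommGroup.primaryComponent (DiscGroup β) p ≃+ ZMod (p ^ k) × ZMod (p ^ (k + e))) := by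
  have hpp : Prime (p : ℤ) := Nat.prime_iff_prime_int.mp hp
  have h2 : ¬ (p : ℤ) ∣ 2 := fun h =>
    hp2 ((Nat.prime_dvd_prime_iff_eq hp Nat.prime_two).mp (by exact_mod_cast h))
  have hpz : (p : ℤ) ≠ 0 := hpp.ne_zero
  obtain ⟨f, -⟩ := exists_primaryComponent_equiv hs he hg hp k e (p₁ := b 0)
    (p₂ := (-B) • b 0 + (2 * A) • b 1) (α := 2 * g' * A) (ν := 0) (γ := -2 * A * g' * D')
    (by rw [hg.1, hk]; ring)
    (by simp only [map_add, map_zsmul, hg.1, hg.2.1, smul_eq_mul]; ring)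
    (by
      rw [hg.apply]
      simp
      rw [hk]
      linear_combination (-2 * A * p ^ k * g') * hD + 2 * A * g' * D' * (pow_add (p : ℤ) k e))
    (fun x => by
      rw [hg.apply, hk]
      exact ⟨g' * (2 * A * b.repr x 0 + B * b.repr x 1), by simp; ring⟩)
    (fun x => by
      rw [hg.apply]
      refine ⟨-g' * D' * b.repr x 1, ?_⟩
      simp
      rw [hk]
      linear_combination (-b.repr x 1 * p ^ k * g') * hD + g' * D' * b.repr x 1 * (pow_add (p : ℤ) k e))
    (by
      have : 2 * g' * A * (-2 * A * g' * D') - p ^ e * 0 ^ 2 = -(2 * 2 * A * A * g' * g' * D') := by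
        ring
      rw [this, dvd_neg]
      simp only [hpp.dvd_mul, not_or]
      exact ⟨⟨⟨⟨⟨⟨h2, h2⟩, hA⟩, hA⟩, hg'⟩, hg'⟩, hD'⟩)
  exact ⟨f⟩

/-- An even middle coefficient makes the Gram matrix `2g` times an integral one, so the orthogonal
vector can be taken as `-B b 0 + A b 1`, with `A` odd, and the form is diagonal over `ℤ₂`. -/
theorem exists_equiv_two_of_even (hs : β.IsSymm) (he : ∀ x, Even (β x x)) {g A B C : ℤ}
    (hg : HasGram β b (g * A) (g * (2 * B)) (g * C)) {k e : ℕ}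
    {g' d' : ℤ} (hk : 2 * g = 2 ^ k * g') (hD : B ^ 2 - A * C = 2 ^ e * d') (hg' : Odd g')
    (hd' : Odd d') (hA : Odd A) :
    ∃ f : AddCommGroup.primaryComponent (DiscGroup β) 2 ≃+ ZMod (2 ^ k) × ZMod (2 ^ (k + e)),
      ∀ a₁ a₂ : ℤ, discForm β hs he (f.symm ((a₁ : ZMod (2 ^ k)), (a₂ : ZMod (2 ^ (k + e))))) =
        (((g' * A : ℤ) * a₁ ^ 2 / 2 ^ k + (-(A * g' * d') : ℤ) * a₂ ^ 2 / 2 ^ (k + e) : ℚ) :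
          AddCircle (2 : ℚ)) := by
  obtain ⟨f, hf⟩ := exists_primaryComponent_equiv hs he hg Nat.prime_two k e (p₁ := b 0)
    (p₂ := (-B) • b 0 + A • b 1) (α := g' * A) (ν := 0) (γ := -(A * g' * d'))
    (by rw [hg.1]; push_cast; linear_combination A * hk)
    (by simp only [map_add, map_zsmul, hg.1, hg.2.1, smul_eq_mul]; ring)
    (by
      rw [hg.apply]
      simp
      linear_combination (-A * 2 * g) * hD - A * 2 ^ e * d' * hk + A * g' * d' * (pow_add (2 : ℤ) k e))
    (fun x => by
      rw [hg.apply]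
      refine ⟨g' * (A * b.repr x 0 + B * b.repr x 1), ?_⟩
      simp
      linear_combination (A * b.repr x 0 + B * b.repr x 1) * hk)
    (fun x => by
      rw [hg.apply]
      refine ⟨-g' * d' * b.repr x 1, ?_⟩
      simp
      linear_combination (-b.repr x 1 * 2 * g) * hD - b.repr x 1 * 2 ^ e * d' * hk +
        g' * d' * b.repr x 1 * (pow_add (2 : ℤ) k e))
    (by
      have : Odd (g' * A * -(A * g' * d') - ((2 : ℕ) : ℤ) ^ e * 0 ^ 2) := by
        obtain ⟨r, hr⟩ := ((hg'.mul hA).mul ((hA.mul hg').mul hd')).neg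
        exact ⟨r, by linear_combination hr⟩
      rw [← Int.not_even_iff_odd, even_iff_two_dvd] at this
      exact_mod_cast this)
  refine ⟨f, fun a₁ a₂ => ?_⟩
  rw [hf]
  congr 1
  push_cast
  ring

/-- The Gram matrix is `2 ^ k` times a `2`-adically unimodular one. A congruence modulo `2 ^ k`
between the binary forms suffices, because it changes `q` by even integers. -/
theorem exists_equiv_two_of_odd (hs : β.IsSymm) (he : ∀ x, Even (β x x)) {g A B C : ℤ}
    (hg : HasGram β b (g * A) (g * B) (g * C)) {k : ℕ} {g' θ u v w : ℤ} (hk : g = 2 ^ k * g')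
    (hB : Odd B) (hg' : Odd g') (hθ : TwoAdicEquiv k A B C θ u v w) :
    ∃ f : AddCommGroup.primaryComponent (DiscGroup β) 2 ≃+ ZMod (2 ^ k) × ZMod (2 ^ k),
      ∀ a₁ a₂ : ℤ, discForm β hs he (f.symm ((a₁ : ZMod (2 ^ k)), (a₂ : ZMod (2 ^ k)))) =
        (((g' * θ : ℤ) * (u * a₁ ^ 2 + v * (a₁ * a₂) + w * a₂ ^ 2) / (2 : ℚ) ^ ((k : ℤ) - 1) : ℚ) :
          AddCircle (2 : ℚ)) := by
  obtain ⟨s, t, s', t', hdet, ⟨m1, h1⟩, ⟨m2, h2⟩, ⟨m3, h3⟩⟩ := hθ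
  obtain ⟨f, hf⟩ := exists_primaryComponent_equiv hs he hg Nat.prime_two k 0
    (p₁ := s • b 0 + t • b 1) (p₂ := s' • b 0 + t' • b 1)
    (α := 2 * g' * (A * s ^ 2 + B * s * t + C * t ^ 2))
    (ν := g' * (2 * A * s * s' + B * (s * t' + t * s') + 2 * C * t * t'))
    (γ := 2 * g' * (A * s' ^ 2 + B * s' * t' + C * t' ^ 2))
    (by rw [hg.apply, hk]; simp; ring)
    (by rw [hg.apply, hk]; simp; ring)
    (by rw [hg.apply, hk]; simp; ring)
    (fun x => by
      rw [hg.apply, hk]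
      exact ⟨g' * (2 * A * (s * b.repr x 0) + B * (s * b.repr x 1 + t * b.repr x 0) +
        2 * C * (t * b.repr x 1)), by simp; ring⟩)
    (fun x => by
      rw [hg.apply, hk]
      exact ⟨g' * (2 * A * (s' * b.repr x 0) + B * (s' * b.repr x 1 + t' * b.repr x 0) +
        2 * C * (t' * b.repr x 1)), by simp; ring⟩)
    (by
      have : Odd (2 * g' * (A * s ^ 2 + B * s * t + C * t ^ 2) *
          (2 * g' * (A * s' ^ 2 + B * s' * t' + C * t' ^ 2)) - ((2 : ℕ) : ℤ) ^ 0 *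
          (g' * (2 * A * s * s' + B * (s * t' + t * s') + 2 * C * t * t')) ^ 2) := by
        have h : Odd (4 * (g' ^ 2 * (s * t' - t * s') ^ 2 * A * C) -
            g' ^ 2 * (s * t' - t * s') ^ 2 * B ^ 2) :=
          Even.sub_odd ⟨2 * (g' ^ 2 * (s * t' - t * s') ^ 2 * A * C), by ring⟩
            ((hg'.pow.mul hdet.pow).mul hB.pow)
        convert h using 1; ring
      rw [← Int.not_even_iff_odd, even_iff_two_dvd] at this
      exact_mod_cast this)
  refine ⟨f, fun a₁ a₂ => (hf a₁ a₂).trans ?_⟩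
  refine addCircle_two_eq (g' * (m1 * a₁ ^ 2 + m2 * (a₁ * a₂) + m3 * a₂ ^ 2)) ?_
  rw [zpow_sub_one₀ two_ne_zero, zpow_natCast]
  have e1 : (A : ℚ) * s ^ 2 + B * s * t + C * t ^ 2 = 2 ^ k * m1 + θ * u := by
    exact_mod_cast (sub_eq_iff_eq_add.mp h1)
  have e2 : 2 * (A : ℚ) * s * s' + B * (s * t' + t * s') + 2 * C * t * t' = 2 ^ k * m2 + θ * v := by
    exact_mod_cast (sub_eq_iff_eq_add.mp h2)
  have e3 : (A : ℚ) * s' ^ 2 + B * s' * t' + C * t' ^ 2 = 2 ^ k * m3 + θ * w := by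
    exact_mod_cast (sub_eq_iff_eq_add.mp h3)
  push_cast
  rw [e1, e2, e3, add_zero]
  field_simp
  ring
end

theorem exists_eq_prime_pow_mul {p : ℕ} (hp : p.Prime) {n : ℤ} (hn : n ≠ 0) :
    ∃ (k : ℕ) (m : ℤ), n = p ^ k * m ∧ ¬ (p : ℤ) ∣ m := by
  have h : FiniteMultiplicity (p : ℤ) n :=
    Int.finiteMultiplicity_iff.mpr ⟨by simpa using hp.ne_one, hn⟩
  obtain ⟨m, h1, h2⟩ := h.exists_eq_pow_mul_and_not_dvd
  exact ⟨_, m, h1, h2⟩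

theorem odd_of_not_two_dvd {n : ℤ} (h : ¬ ((2 : ℕ) : ℤ) ∣ n) : Odd n := by
  rw [← Int.not_even_iff_odd, even_iff_two_dvd]
  exact_mod_cast h

theorem even_of_even_discr {A B C : ℤ} (h : Even (B ^ 2 - 4 * A * C)) : Even B := by
  have : Even (B ^ 2) := by
    have := h.add (show Even (4 * A * C) from ⟨2 * A * C, by ring⟩)
    rwa [sub_add_cancel] at this
  simpa [Int.even_pow] using this

/-! ### The discriminant form against the divisibility of `D`. -/

section
variable {M : Type*} [AddCommGroup M] {β : LinearMap.BilinForm ℤ M} {b : Basis (Fin 2) ℤ M}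

theorem primaryComponent_homogeneous_iff (hs : β.IsSymm) (he : ∀ x, Even (β x x)) {g A B C : ℤ}
    (hg : HasGram β b (g * A) (g * B) (g * C)) (hg0 : g ≠ 0) (hD : B ^ 2 - 4 * A * C ≠ 0)
    (hprim : ∀ p : ℕ, p.Prime → (p : ℤ) ∣ A → (p : ℤ) ∣ B → (p : ℤ) ∣ C → False)
    {p : ℕ} (hp : p.Prime) (hp2 : p ≠ 2) :
    (∃ k : ℕ, Nonempty (AddCommGroup.primaryComponent (DiscGroup β) p ≃+
      ZMod (p ^ k) × ZMod (p ^ k))) ↔ ¬ (p : ℤ) ∣ B ^ 2 - 4 * A * C := by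
  obtain ⟨k, g', hk, hg'⟩ := exists_eq_prime_pow_mul hp hg0
  obtain ⟨e, D', hDe, hD'⟩ := exists_eq_prime_pow_mul hp hD
  obtain ⟨b', A', B', C', hb', hdisc, hA'⟩ := exists_basis_not_dvd hg hprim hp
  rw [← hdisc] at hDe
  obtain ⟨f⟩ := exists_equiv_of_odd_prime hs he hb' hp hp2 hk hDe hg' hD' hA'
  rw [← hdisc, hDe]
  constructor
  · rintro ⟨l, ⟨f'⟩⟩
    obtain ⟨h1, h2⟩ := zmod_prod_exponents hp le_rfl (f.symm.trans f')
    have h3 : e = 0 := by omega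
    rwa [h3, pow_zero, one_mul]
  · intro h
    have h3 : e = 0 := by
      by_contra h0
      exact h ((dvd_pow_self _ h0).mul_right _)
    subst h3
    exact ⟨k, ⟨f⟩⟩

/-- The two-primary component of the discriminant form determines whether `16` divides the
discriminant of the primitive part of the form. -/
theorem not_sixteen_dvd_of_equiv (hs : β.IsSymm) (he : ∀ x, Even (β x x)) {g A B C : ℤ}
    (hg : HasGram β b (g * A) (g * B) (g * C)) (hg0 : g ≠ 0) (hD : B ^ 2 - 4 * A * C ≠ 0)
    (hprim : ∀ p : ℕ, p.Prime → (p : ℤ) ∣ A → (p : ℤ) ∣ B → (p : ℤ) ∣ C → False)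
    {l i : ℕ} (hi : i ≤ 1) (f' : AddCommGroup.primaryComponent (DiscGroup β) 2 ≃+
      ZMod (2 ^ l) × ZMod (2 ^ (l + i))) : ¬ (16 : ℤ) ∣ B ^ 2 - 4 * A * C := by
  intro h16
  obtain ⟨b', A', B', C', hb', hdisc, hA'⟩ := exists_basis_not_dvd hg hprim Nat.prime_two
  rw [← hdisc] at h16 hD
  obtain ⟨c, hc⟩ := h16
  have hev : Even (B' ^ 2 - 4 * A' * C') := ⟨8 * c, by rw [hc]; ring⟩
  obtain ⟨B', rfl⟩ := (even_of_even_discr hev).two_dvd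
  have hd0 : B' ^ 2 - A' * C' ≠ 0 := fun h => hD (by linear_combination 4 * h)
  obtain ⟨e, d', hde, hd'⟩ := exists_eq_prime_pow_mul Nat.prime_two hd0
  obtain ⟨k, g', hk, hg'⟩ := exists_eq_prime_pow_mul Nat.prime_two (mul_ne_zero two_ne_zero hg0)
  obtain ⟨f, -⟩ := exists_equiv_two_of_even hs he hb' hk hde (odd_of_not_two_dvd hg')
    (odd_of_not_two_dvd hd') (odd_of_not_two_dvd hA')
  obtain ⟨h1, h2⟩ := zmod_prod_exponents Nat.prime_two (Nat.le_add_right l i) (f.symm.trans f')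
  have h4 : B' ^ 2 - A' * C' = 4 * c := by linarith
  obtain ⟨r, hr⟩ := odd_of_not_two_dvd hd'
  -- `16 ∣ D` means `4 ∣ 2 ^ e d'` with `d'` odd, hence `e ≥ 2`, whereas the cyclic factors differ
  -- by at most one exponent.
  have he1 : e ≤ 1 := by omega
  interval_cases e
  · simp at hde; omega
  · simp at hde; omega

/-- The condition on the discriminant form of an even lattice that characterizes self-mirror
abelian surfaces. -/
def DiscCondition (β : LinearMap.BilinForm ℤ M) (hs : β.IsSymm) (he : ∀ x, Even (β x x)) : Prop :=
      (∀ p : ℕ, p.Prime → p % 4 = 3 → ∃ k : ℕ, Nonempty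
        (AddCommGroup.primaryComponent (DiscGroup β) p ≃+ ZMod (p ^ k) × ZMod (p ^ k))) ∧
      ((∃ k : ℕ, 1 ≤ k ∧ ∃ (e : AddCommGroup.primaryComponent (DiscGroup β) 2 ≃+
          ZMod (2 ^ k) × ZMod (2 ^ k)) (θ₁ θ₂ : ℤ), Odd θ₁ ∧ Odd θ₂ ∧ 4 ∣ θ₁ + θ₂ ∧
          ∀ a₁ a₂ : ℤ, discForm β hs he (e.symm ((a₁ : ZMod (2 ^ k)), (a₂ : ZMod (2 ^ k)))) =
            ((θ₁ * a₁ ^ 2 / 2 ^ k + θ₂ * a₂ ^ 2 / 2 ^ k : ℚ) : AddCircle (2 : ℚ))) ∨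
        (∃ k : ℕ, 1 ≤ k ∧ ∃ (e : AddCommGroup.primaryComponent (DiscGroup β) 2 ≃+
          ZMod (2 ^ k) × ZMod (2 ^ (k + 1))) (θ₁ θ₂ : ℤ), Odd θ₁ ∧ Odd θ₂ ∧ 4 ∣ θ₁ + θ₂ ∧
          ∀ a₁ a₂ : ℤ, discForm β hs he
            (e.symm ((a₁ : ZMod (2 ^ k)), (a₂ : ZMod (2 ^ (k + 1))))) =
            ((θ₁ * a₁ ^ 2 / 2 ^ k + θ₂ * a₂ ^ 2 / 2 ^ (k + 1) : ℚ) : AddCircle (2 : ℚ))) ∨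
        (∃ (k : ℕ) (e : AddCommGroup.primaryComponent (DiscGroup β) 2 ≃+
          ZMod (2 ^ k) × ZMod (2 ^ k)) (θ : ℤ), Odd θ ∧
          ∀ a₁ a₂ : ℤ, discForm β hs he (e.symm ((a₁ : ZMod (2 ^ k)), (a₂ : ZMod (2 ^ k)))) =
            ((θ * (a₁ * a₂) / (2 : ℚ) ^ ((k : ℤ) - 1) : ℚ) : AddCircle (2 : ℚ))) ∨
        (∃ (k : ℕ) (e : AddCommGroup.primaryComponent (DiscGroup β) 2 ≃+
          ZMod (2 ^ k) × ZMod (2 ^ k)) (θ : ℤ), Odd θ ∧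
          ∀ a₁ a₂ : ℤ, discForm β hs he (e.symm ((a₁ : ZMod (2 ^ k)), (a₂ : ZMod (2 ^ k)))) =
            ((θ * (a₁ ^ 2 + a₁ * a₂ + a₂ ^ 2) / (2 : ℚ) ^ ((k : ℤ) - 1) : ℚ) :
              AddCircle (2 : ℚ))))

theorem discr_condition_iff (hs : β.IsSymm) (he : ∀ x, Even (β x x)) {g A B C : ℤ}
    (hg : HasGram β b (g * A) (g * B) (g * C)) (hg0 : g ≠ 0) (hD : 0 < B ^ 2 - 4 * A * C)
    (hprim : ∀ p : ℕ, p.Prime → (p : ℤ) ∣ A → (p : ℤ) ∣ B → (p : ℤ) ∣ C → False) :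
    ((∀ p : ℕ, p.Prime → p % 4 = 3 → ¬ (p : ℤ) ∣ B ^ 2 - 4 * A * C) ∧
        ¬ (16 : ℤ) ∣ B ^ 2 - 4 * A * C) ↔
      DiscCondition β hs he := by
  have h3 : ∀ p : ℕ, p.Prime → p % 4 = 3 → (_ ↔ _) := fun p hp hp3 =>
    primaryComponent_homogeneous_iff hs he hg hg0 hD.ne' hprim hp (by rintro rfl; omega)
  constructor
  · rintro ⟨hp, h16⟩
    refine ⟨fun p hpp hp3 => (h3 p hpp hp3).mpr (hp p hpp hp3), ?_⟩
    obtain ⟨j, g', hj, hg'⟩ := exists_eq_prime_pow_mul Nat.prime_two hg0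
    have hg'' := odd_of_not_two_dvd hg'
    rcases Int.even_or_odd (B ^ 2 - 4 * A * C) with hev | hodd
    · obtain ⟨b', A', B', C', hb', hdisc, hA'⟩ := exists_basis_not_dvd hg hprim Nat.prime_two
      rw [← hdisc] at hev h16 hD hp
      obtain ⟨B', rfl⟩ := (even_of_even_discr hev).two_dvd
      have hd4 : (2 * B') ^ 2 - 4 * A' * C' = 4 * (B' ^ 2 - A' * C') := by ring
      rw [hd4] at h16 hD hp
      have hd0 : 0 < B' ^ 2 - A' * C' := by linarith
      have h4 : ¬ (4 : ℤ) ∣ B' ^ 2 - A' * C' := fun h => h16 (by simpa using mul_dvd_mul_left 4 h)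
      obtain ⟨e, d', hde, hd'⟩ := exists_eq_prime_pow_mul Nat.prime_two hd0.ne'
      have hd'' := odd_of_not_two_dvd hd'
      have hd'pos : 0 < d' := by
        rw [hde] at hd0
        exact pos_of_mul_pos_right hd0 (by positivity)
      -- The odd part of `D/4` is positive without prime factors `3` modulo `4`, so it is an odd sum
      -- of two squares, hence `1` modulo `4`. This gives the congruence on `θ₁ + θ₂`.
      have hd'4 : (4 : ℤ) ∣ 1 - d' := by
        obtain ⟨r, s, hrs, -, hs'⟩ := exists_coprime_sq_add_sq hd'pos
          (fun p hpp hp3 h => hp p hpp hp3 (by rw [hde]; exact (h.mul_left _).mul_left _))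
          (fun h => hd' ((show ((2 : ℕ) : ℤ) ∣ 4 by norm_num).trans h))
        have hr : Even r := by
          rw [hrs] at hd''
          by_contra hr
          rw [Int.not_even_iff_odd] at hr
          exact (Int.not_even_iff_odd.mpr hd'') (hr.pow.add_odd hs'.pow)
        obtain ⟨r, rfl⟩ := hr.two_dvd
        obtain ⟨s, rfl⟩ := hs'
        exact ⟨-r ^ 2 - s ^ 2 - s, by rw [hrs]; ring⟩
      -- The extra factor `2` is the source of `k ≥ 1` in the diagonal cases.
      have hk : 2 * g = 2 ^ (j + 1) * g' := by rw [hj]; push_cast; ring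
      have hA'' := odd_of_not_two_dvd hA'
      obtain ⟨f, hf⟩ := exists_equiv_two_of_even hs he hb' hk hde hg'' hd'' hA''
      have hθ : 4 ∣ g' * A' + -(A' * g' * d') :=
        (hd'4.mul_left (g' * A')).trans (dvd_of_eq (by ring))
      have he1 : e ≤ 1 := by
        by_contra! h
        exact h4 (hde ▸ ((pow_dvd_pow 2 h).mul_right d'))
      interval_cases e
      · exact Or.inl ⟨j + 1, by omega, f, _, _, hg''.mul hA'', ((hA''.mul hg'').mul hd'').neg, hθ, hf⟩
      · exact Or.inr (Or.inl
          ⟨j + 1, by omega, f, _, _, hg''.mul hA'', ((hA''.mul hg'').mul hd'').neg, hθ, hf⟩)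
    · have hB : Odd B := by
        by_contra hB
        rw [Int.not_odd_iff_even] at hB
        refine (Int.not_even_iff_odd.mpr hodd) (Even.sub ?_ ⟨2 * A * C, by ring⟩)
        exact hB.pow_of_ne_zero two_ne_zero
      right; right
      have key : ∀ θ : ℤ, Odd θ → TwoAdicEquiv j A B C θ 0 1 0 →
          ∃ (k : ℕ) (e : AddCommGroup.primaryComponent (DiscGroup β) 2 ≃+
          ZMod (2 ^ k) × ZMod (2 ^ k)) (θ : ℤ), Odd θ ∧
          ∀ a₁ a₂ : ℤ, discForm β hs he (e.symm ((a₁ : ZMod (2 ^ k)), (a₂ : ZMod (2 ^ k)))) =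
            ((θ * (a₁ * a₂) / (2 : ℚ) ^ ((k : ℤ) - 1) : ℚ) : AddCircle (2 : ℚ)) := by
        intro θ hθ hθ'
        obtain ⟨f, hf⟩ := exists_equiv_two_of_odd hs he hg hj hB hg'' hθ'
        refine ⟨j, f, g' * θ, hg''.mul hθ, fun a₁ a₂ => ?_⟩
        rw [hf]
        simp
      -- Over `ℤ₂` a binary form with odd middle coefficient is hyperbolic unless both outer
      -- coefficients are odd.
      by_cases hA : Even A
      · obtain ⟨θ, hθ, hθ'⟩ := exists_twoAdicEquiv_hyperbolic_of_even (c := C) hB hA j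
        exact Or.inl (key θ hθ hθ')
      · by_cases hC : Even C
        · obtain ⟨θ, hθ, hθ'⟩ := exists_twoAdicEquiv_hyperbolic_of_even (c := A) hB hC j
          exact Or.inl (key θ hθ hθ'.swap)
        · rw [Int.not_even_iff_odd] at hA hC
          obtain ⟨f, hf⟩ := exists_equiv_two_of_odd hs he hg hj hB hg''
            (exists_twoAdicEquiv_anisotropic hB hA hC j)
          refine Or.inr ⟨j, f, g' * A, hg''.mul hA, fun a₁ a₂ => ?_⟩
          rw [hf]
          simp
  · rintro ⟨ha, hb⟩
    refine ⟨fun p hpp hp3 => (h3 p hpp hp3).mp (ha p hpp hp3), ?_⟩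
    rcases hb with ⟨k, -, f, -⟩ | ⟨k, -, f, -⟩ | ⟨k, f, -⟩ | ⟨k, f, -⟩
    · exact not_sixteen_dvd_of_equiv hs he hg hg0 hD.ne' hprim (i := 0) (by omega) f
    · exact not_sixteen_dvd_of_equiv hs he hg hg0 hD.ne' hprim (i := 1) (by omega) f
    · exact not_sixteen_dvd_of_equiv hs he hg hg0 hD.ne' hprim (i := 0) (by omega) f
    · exact not_sixteen_dvd_of_equiv hs he hg hg0 hD.ne' hprim (i := 0) (by omega) f
end

/-! ### Conclusion. -/

/-- Every nonzero binary form is a multiple of a primitive one. -/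
theorem exists_primitive_part {A : ℤ} (hA : A ≠ 0) (B C : ℤ) :
    ∃ g a b c : ℤ, A = g * a ∧ B = g * b ∧ C = g * c ∧
      ∀ p : ℕ, p.Prime → (p : ℤ) ∣ a → (p : ℤ) ∣ b → (p : ℤ) ∣ c → False := by
  set g : ℤ := (Int.gcd A (Int.gcd B C) : ℤ) with hg
  have hg0 : g ≠ 0 := fun h => hA (by
    rw [hg, Int.natCast_eq_zero] at h
    exact (Int.gcd_eq_zero_iff.mp h).1)
  have h2 : g ∣ (Int.gcd B C : ℤ) := Int.gcd_dvd_right ..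
  obtain ⟨a, ha⟩ : g ∣ A := Int.gcd_dvd_left ..
  obtain ⟨b, hb⟩ := h2.trans (Int.gcd_dvd_left ..)
  obtain ⟨c, hc⟩ := h2.trans (Int.gcd_dvd_right ..)
  refine ⟨g, a, b, c, ha, hb, hc, fun p hp h1 h2 h3 => ?_⟩
  have h4 : g * p ∣ g := Int.dvd_coe_gcd (ha ▸ mul_dvd_mul_left g h1)
    (Int.dvd_coe_gcd (hb ▸ mul_dvd_mul_left g h2) (hc ▸ mul_dvd_mul_left g h3))
  have h5 : (p : ℤ) ∣ 1 := by
    obtain ⟨m, hm⟩ := h4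
    exact ⟨m, mul_left_cancel₀ hg0 (by linear_combination hm)⟩
  exact (Nat.prime_iff_prime_int.mp hp).not_isUnit (isUnit_of_dvd_one h5)

theorem Isometric.symm {M N : Type*} [AddCommGroup M] [AddCommGroup N]
    {β : LinearMap.BilinForm ℤ M} {γ : LinearMap.BilinForm ℤ N} (h : Isometric β γ) :
    Isometric γ β := by
  obtain ⟨e, he⟩ := h
  exact ⟨e.symm, fun x y => by rw [← he, e.apply_symm_apply, e.apply_symm_apply]⟩

theorem Isometric.trans {M N L : Type*} [AddCommGroup M] [AddCommGroup N] [AddCommGroup L]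
    {β : LinearMap.BilinForm ℤ M} {γ : LinearMap.BilinForm ℤ N} {δ : LinearMap.BilinForm ℤ L}
    (h : Isometric β γ) (h' : Isometric γ δ) : Isometric β δ := by
  obtain ⟨e, he⟩ := h
  obtain ⟨f, hf⟩ := h'
  exact ⟨e.trans f, fun x y => by rw [e.trans_apply, e.trans_apply, hf, he]⟩

theorem isSelfMirror_iff {V : Type*} [NormedAddCommGroup V] [NormedSpace ℂ V]
    [Fact (Module.finrank ℂ V = 2)] (Λ : Submodule ℤ V) [DiscreteTopology Λ] [IsZLattice ℝ Λ]
    (hX : IsAbelian Λ) (hρ : picardNumber Λ = 2) :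
    IsSelfMirror Λ ↔ DiscCondition (nsForm Λ) (nsForm_isSymm Λ) (nsForm_even Λ) := by
  -- A non-isotropic first vector gives `A ≠ 0`, which the explicit isometry needs for coprimality
  -- of `2Ap` and `n`.
  obtain ⟨b₀, hb₀⟩ := exists_basis_NS Λ hX hρ
  obtain ⟨b, A, B, C, hb, hg, hT⟩ := exists_isometric_transForm Λ b₀
  have hN := isometric_numForm Λ b hg
  have hA : A ≠ 0 := by
    rintro rfl
    exact hb₀ (by rw [← hb, hg.1, mul_zero])
  have hD := discr_pos Λ hX hg
  obtain ⟨g, A, B, C, rfl, rfl, rfl, hprim⟩ := exists_primitive_part hA B C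
  have hg0 : g ≠ 0 := left_ne_zero_of_mul hA
  have hD' : 0 < B ^ 2 - 4 * A * C := by
    have : 0 < g ^ 2 * (B ^ 2 - 4 * A * C) := by linarith
    exact pos_of_mul_pos_right this (sq_nonneg g)
  have hiso : IsSelfMirror Λ ↔ Isometric
      (Matrix.toBilin' (planeGram (-(g * A)) (-(g * B)) (-(g * C))))
      (Matrix.toBilin' (planeGram (g * A) (g * B) (g * C))) :=
    ⟨fun h => (hT.symm.trans h).trans hN, fun h => (hT.trans h).trans hN.symm⟩
  rw [hiso, isometric_neg_plane_iff hA hD' hprim]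
  exact discr_condition_iff (nsForm_isSymm Λ) (nsForm_even Λ) hg hg0 hD' hprim

end AbelianSurface

theorem mainTheorem1 {V : Type*} [NormedAddCommGroup V] [NormedSpace ℂ V]
    [Fact (Module.finrank ℂ V = 2)] (Λ : Submodule ℤ V) [DiscreteTopology Λ] [IsZLattice ℝ Λ]
    (hX : IsAbelian Λ) (hρ : picardNumber Λ = 2) :
    IsSelfMirror Λ ↔
      (∀ p : ℕ, p.Prime → p % 4 = 3 →
        ∃ k : ℕ, Nonempty (sylowDiscNS Λ p ≃+ ZMod (p ^ k) × ZMod (p ^ k))) ∧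
      ((∃ k : ℕ, 1 ≤ k ∧ ∃ (e : sylowDiscNS Λ 2 ≃+ ZMod (2 ^ k) × ZMod (2 ^ k)) (θ₁ θ₂ : ℤ),
          Odd θ₁ ∧ Odd θ₂ ∧ 4 ∣ θ₁ + θ₂ ∧
          ∀ a₁ a₂ : ℤ, qNS Λ (e.symm ((a₁ : ZMod (2 ^ k)), (a₂ : ZMod (2 ^ k)))) =
            ((θ₁ * a₁ ^ 2 / 2 ^ k + θ₂ * a₂ ^ 2 / 2 ^ k : ℚ) : AddCircle (2 : ℚ))) ∨
        (∃ k : ℕ, 1 ≤ k ∧ ∃ (e : sylowDiscNS Λ 2 ≃+ ZMod (2 ^ k) × ZMod (2 ^ (k + 1))) (θ₁ θ₂ : ℤ),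
          Odd θ₁ ∧ Odd θ₂ ∧ 4 ∣ θ₁ + θ₂ ∧
          ∀ a₁ a₂ : ℤ, qNS Λ (e.symm ((a₁ : ZMod (2 ^ k)), (a₂ : ZMod (2 ^ (k + 1))))) =
            ((θ₁ * a₁ ^ 2 / 2 ^ k + θ₂ * a₂ ^ 2 / 2 ^ (k + 1) : ℚ) : AddCircle (2 : ℚ))) ∨
        (∃ (k : ℕ) (e : sylowDiscNS Λ 2 ≃+ ZMod (2 ^ k) × ZMod (2 ^ k)) (θ : ℤ), Odd θ ∧
          ∀ a₁ a₂ : ℤ, qNS Λ (e.symm ((a₁ : ZMod (2 ^ k)), (a₂ : ZMod (2 ^ k)))) =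
            ((θ * (a₁ * a₂) / (2 : ℚ) ^ ((k : ℤ) - 1) : ℚ) : AddCircle (2 : ℚ))) ∨
        (∃ (k : ℕ) (e : sylowDiscNS Λ 2 ≃+ ZMod (2 ^ k) × ZMod (2 ^ k)) (θ : ℤ), Odd θ ∧
          ∀ a₁ a₂ : ℤ, qNS Λ (e.symm ((a₁ : ZMod (2 ^ k)), (a₂ : ZMod (2 ^ k)))) =
            ((θ * (a₁ ^ 2 + a₁ * a₂ + a₂ ^ 2) / (2 : ℚ) ^ ((k : ℤ) - 1) : ℚ) :
              AddCircle (2 : ℚ)))) :=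
  isSelfMirror_iff Λ hX hρ
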